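/- **Setting.** Fix integers $n\ge 2$ and $D\ge 2n+1$. *Manifolds.* A *closed manifold* means a closed smooth $(n-1)$-manifold $M$ (possibly empty), smoothly embedded in $\mathbb R^D$ so that each connected component lies in a slice $\{k\}\times\mathbb R^{D-1}$, $k\in\mathbb N$. A *cobordism* from $M$ to $N$ is a compact smoothly embedded $n$-manifold $W\subset[0,1]\times\mathbb R^D$ with $\partial W=(\{0\}\times M)\sqcup(\{1\}\times N)$ and $W-\partial W\subset(0,1)\times\mathbb R^D$, each component of which lies in a slice $[0,1]\times\{k\}\times\mathbb R^{D-1}$, and which has a *cylinder scale*, i.e. a number $0<\varepsilon<\frac12$ with $W\cap([0,\varepsilon]\times\mathbb R^D)=[0,\varepsilon]\times M$ and $W\cap([1-\varepsilon,1]\times\mathbb R^D)=[1-\varepsilon,1]\times N$. Let $M(k)$, $W(k)$ be the parts in the $k$-th slice and $W_t=W\cap(\{t\}\times\mathbb R^D)$. *Algebra.* Let $\mathbf{Br}$ be the Brauer category: its objects are $[m]$, $m\in\mathbb N$; a morphism $[m]\to[n]$ is a perfect matching of $m$ incoming and $n$ outgoing points together with a number of loops; the tensor product $\phi\otimes\psi$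 stacks $\psi$ on top of $\phi$ and adds the numbers of loops. Let $V$ be a real vector space of finite dimension $\ge 2$ with a duality structure, i.e. a symmetric copairing $i:\mathbb R\to V\otimes V$ and a symmetric pairing $e:V\otimes V\to\mathbb R$ with $(e\otimes 1)(1\otimes i)=1$. Let $Y$ be the symmetric strict monoidal functor from $\mathbf{Br}$ to vector spaces with $Y([1])=V$ that sends the elementary cup and cap to $i$ and $e$ and the loop to $e\circ i$. Assume that $Y$ is faithful on loops: if $\phi,\psi:[m]\to[n]$ satisfy $Y(\phi)=Y(\psi)$, then they have the same number of loops. Let $H_{m,n}=Y(\mathrm{Hom}([m],[n]))$, and let $\mathbb B$ be the Boolean semiring. Put $Q(H_{m,n})=FM(H_{m,n})\otimes_{\mathbb N[\tau]}\mathbb B[[q]]$, where $FM$ is the free commutative monoid, $\tau$ acts on $H_{m,n}$ as multiplication by the scalar $e\circ i$, and $\tau$ acts on $\mathbb B[[q]]$ as multiplication by $q$. Every element of $Q(H_{m,n})$ is uniquely of the form $\sum_y y\otimes b_y$ with $b_y\in\mathbb B[[q]]$, where $y$ runs over the finite set of the $Y(\phi)$ with $\phi:[m]\to[n]$ loop-free.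 Infinite sums in $Q(H_{m,n})$ are formed by summing the coefficients $b_y$ in $\mathbb B[[q]]$, coefficientwise in the complete semiring $\mathbb B$. Let $Q=\prod_{m,n}Q(H_{m,n})$ with componentwise infinite sums. The multiplication $\times$ of the monoidal semiring $Q^m$ is $$(f\times f')_{m,n}=\sum_{p+r=m,\;s+t=n}f_{p,s}\times f'_{r,t},\qquad (y\otimes b)\times(y'\otimes b')=(y\otimes y')\otimes bb'.$$ *Fields.* A smooth map $F:W\to\mathbb C$ is a *fold map* if its $1$-jet extension is transverse to the corank-one stratum, every point of its singular set $S(F)=\{x:\operatorname{rank}D_xF<2\}$ has corank one, and $T_xS(F)+\ker D_xF=T_xW$ for all $x\in S(F)$. It is a *fold field* if moreover, for every $k$ with $W(k)\neq\varnothing$ and with $F(k)=F|_{W(k)}$: the times $t=0,1$ are regular values of the time function of $W(k)$ at which $S(F(k))$ is transverse to $W(k)_t$ and $\operatorname{Im}F$ is injective on $S(F(k))\cap W(k)_t$; and the set of $t\in[0,1]$ for which $\operatorname{Im}F$ is injective on $S(F(k))\cap W(k)_t$ is residual in $[0,1]$. Let $\mathcal F(W)$ be the set of fold fields (one element if $W=\varnothing$).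 The action $\mathbb S(F)$ is the morphism $\bigotimes_{k\in\mathbb N}\mathbb S(F(k))$ of $\mathbf{Br}$. Here $\mathbb S(F(k))$ has as incoming (outgoing) points the points of $S(F(k))$ at time $0$ (time $1$), ordered by $\operatorname{Im}F$; two points are matched if they are the endpoints of one component of $S(F(k))$; and each closed component of $S(F(k))$ contributes one loop. Empty $W(k)$ give the identity of $[0]$. Let $\mathcal F(M)$ be the set of all $f\in\mathcal F([0,1]\times M)$ for which $\mathbb S(f)$ is an identity. For $X\subset\mathbb R^D$ and maps $f$ on $[a,b]\times X$, $f'$ on $[a',b']\times X$, write $f\approx f'$ if there is a diffeomorphism $\xi:[a,b]\to[a',b']$ with $\xi(a)=a'$ and $f(t,x)=f'(\xi(t),x)$ for all $t\in[a,b]$, $x\in X$. If $W$ is a cobordism from $M$ to $N$ with chosen cylinder scale $\varepsilon_W$, and $f_M\in\mathcal F(M)$, $f_N\in\mathcal F(N)$, let $\mathcal F(W;f_M,f_N)$ be the set of all $F\in\mathcal F(W)$ such that for every $k$ there are $\delta,\delta'\in(0,\varepsilon_W)$ with $$F|_{[0,\delta]\times M(k)}\approx f_M|_{[0,1]\times M(k)},\qquad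 F|_{[1-\delta',1]\times N(k)}\approx f_N|_{[0,1]\times N(k)}.$$ *State sums.* Let $Z(M)$ be the module of all functions $\mathcal F(M)\to Q$. Completed tensor products of state modules are identified, by the canonical isomorphisms, with modules of functions on products, e.g. $Z(M)\hat\otimes Z(N)$ with the functions $\mathcal F(M)\times\mathcal F(N)\to Q$. The state sum $Z_W\in Z(M)\hat\otimes Z(N)$ is $$Z_W(f_M,f_N)=\sum_{F\in\mathcal F(W;f_M,f_N)}Y(\mathbb S(F))\otimes 1 .$$ For $\zeta\in Z(M)\hat\otimes Z(N)$ and $\zeta'\in Z(M')\hat\otimes Z(N')$, the monoidal tensor product $\zeta\hat\otimes_m\zeta'\in Z(M)\hat\otimes Z(M')\hat\otimes Z(N)\hat\otimes Z(N')$ is $$(\zeta\hat\otimes_m\zeta')(f_M,f_{M'},f_N,f_{N'})=\zeta(f_M,f_N)\times\zeta'(f_{M'},f_{N'}).$$ **Theorem.** Let $W\subset[0,1]\times\{0\}\times\mathbb R^{D-1}$ be a cobordism from $M$ to $N$ and $W'\subset[0,1]\times\{1\}\times\mathbb R^{D-1}$ a cobordism from $M'$ to $N'$, and let $\varepsilon$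 be a cylinder scale of both $W$ and $W'$. Then $W\sqcup W'$ is a cobordism from $M\sqcup M'$ to $N\sqcup N'$ with cylinder scale $\varepsilon$. The disjoint union of fields $(f,f')\mapsto f\sqcup f'$ defines bijections $$\mathcal F(M)\times\mathcal F(M')\cong\mathcal F(M\sqcup M'),\qquad \mathcal F(N)\times\mathcal F(N')\cong\mathcal F(N\sqcup N').$$ Let $$\rho:Z(M\sqcup M')\hat\otimes Z(N\sqcup N')\xrightarrow{\ \cong\ }Z(M)\hat\otimes Z(M')\hat\otimes Z(N)\hat\otimes Z(N')$$ be the induced isomorphism $\rho(z)(f_M,f_{M'},f_N,f_{N'})=z(f_M\sqcup f_{M'},f_N\sqcup f_{N'})$. Then, with $\varepsilon$ as the cylinder scale of $W$, $W'$ and $W\sqcup W'$, $$\rho(Z_{W\sqcup W'})=Z_W\hat\otimes_m Z_{W'} .$$ -/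

import Mathlib

open scoped TensorProduct ContDiff

noncomputable section

namespace FoldTFT

/-! ### The Boolean semiring and its power series -/

/-- The Boolean semiring `𝔹 = {0, 1}` with `1 + 1 = 1`. -/
def BoolSemiring : Type := Bool

namespace BoolSemiring
instance : DecidableEq BoolSemiring := inferInstanceAs (DecidableEq Bool)
instance : Fintype BoolSemiring := inferInstanceAs (Fintype Bool)
instance : Zero BoolSemiring := ⟨false⟩
instance : One BoolSemiring := ⟨true⟩
instance : Add BoolSemiring := ⟨or⟩
instance : Mul BoolSemiring := ⟨and⟩

instance : CommSemiring BoolSemiring where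
  add_assoc := by decide
  zero_add := by decide
  add_zero := by decide
  add_comm := by decide
  mul_assoc := by decide
  one_mul := by decide
  mul_one := by decide
  mul_comm := by decide
  left_distrib := by decide
  right_distrib := by decide
  zero_mul := by decide
  mul_zero := by decide
  nsmul := nsmulRec
end BoolSemiring

/-- The summation law of `𝔹⟦q⟧`, taken coefficientwise from `𝔹`, where a sum is `1` exactly if
some summand is `1`. -/
def seriesSum {ι : Type*} (b : ι → PowerSeries BoolSemiring) : PowerSeries BoolSemiring :=
  open scoped Classical in
  PowerSeries.mk fun k => if ∃ i, PowerSeries.coeff k (b i) = 1 then 1 else 0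

/-! ### The Brauer category -/

/-- A morphism `[m] → [n]` of the Brauer category: a Brauer diagram joining the `m` incoming points
`Sum.inl i` and the `n` outgoing points `Sum.inr j` in pairs, together with a number of loops.
Points are ordered as on the line; `strand x` is the other endpoint of the arc that starts at `x`.
(Tangles in `[0,1] × ℝ³` up to isotopy rel boundary are the same thing as such diagrams.) -/
@[ext] structure BrauerHom (m n : ℕ) where
  strand : Equiv.Perm (Fin m ⊕ Fin n)
  strand_strand : ∀ x, strand (strand x) = x
  strand_ne : ∀ x, strand x ≠ x
  loops : ℕ

namespace BrauerHom

/-- The identity morphism of `[n]`. -/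
def identity (n : ℕ) : BrauerHom n n where
  strand := Equiv.sumComm (Fin n) (Fin n)
  strand_strand := by rintro (x | x) <;> rfl
  strand_ne := by rintro (x | x) <;> simp
  loops := 0

/-- Endpoints of two diagrams, renumbered so that the second is stacked on top of the first. -/
def stackEquiv (m n m' n' : ℕ) :
    (Fin m ⊕ Fin n) ⊕ (Fin m' ⊕ Fin n') ≃ Fin (m + m') ⊕ Fin (n + n') :=
  (Equiv.sumSumSumComm (Fin m) (Fin n) (Fin m') (Fin n')).trans
    (Equiv.sumCongr finSumFinEquiv finSumFinEquiv)

/-- The monoidal product `φ ⊗ ψ`: the diagram `ψ` stacked on top of `φ`. -/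
def tensor {m n m' n' : ℕ} (φ : BrauerHom m n) (ψ : BrauerHom m' n') :
    BrauerHom (m + m') (n + n') where
  strand := (stackEquiv m n m' n').permCongr (Equiv.Perm.sumCongr φ.strand ψ.strand)
  strand_strand := by
    intro x
    obtain ⟨y, rfl⟩ := (stackEquiv m n m' n').surjective x
    rcases y with y | y <;> simp [Equiv.permCongr_apply, φ.strand_strand, ψ.strand_strand]
  strand_ne := by
    intro x
    obtain ⟨y, rfl⟩ := (stackEquiv m n m' n').surjective x
    rcases y with y | y <;> simp [Equiv.permCongr_apply, φ.strand_ne, ψ.strand_ne]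
  loops := φ.loops + ψ.loops

/-- The product with one loop. -/
def addLoop {m n : ℕ} (φ : BrauerHom m n) : BrauerHom m n := { φ with loops := φ.loops + 1 }

end BrauerHom

/-- An element of `Mor(Br)`: a morphism of the Brauer category with its domain and codomain. -/
structure BrauerMor where
  dom : ℕ
  cod : ℕ
  hom : BrauerHom dom cod

namespace BrauerMor

/-- The morphism `1_[n]`. -/
def identity (n : ℕ) : BrauerMor := ⟨n, n, BrauerHom.identity n⟩

/-- The monoidal product on `Mor(Br)`. -/
def tensor (φ ψ : BrauerMor) : BrauerMor := ⟨_, _, φ.hom.tensor ψ.hom⟩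

/-- `φ` is an identity morphism. -/
def IsIdentity (φ : BrauerMor) : Prop := ∃ n, φ = identity n

end BrauerMor

/-! ### Duality structures and the representation `Y` of the Brauer category -/

/-- A duality structure `(i, e)` on a real vector space: a symmetric copairing `i` (the unit) and a
symmetric pairing `e` (the counit) subject to the zig-zag equation `(e ⊗ 1) ∘ (1 ⊗ i) = 1`. -/
structure DualityStructure (V : Type*) [AddCommGroup V] [Module ℝ V] where
  unit : ℝ →ₗ[ℝ] V ⊗[ℝ] V
  counit : V ⊗[ℝ] V →ₗ[ℝ] ℝ
  unit_symm : (TensorProduct.comm ℝ V V).toLinearMap ∘ₗ unit = unit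
  counit_symm : counit ∘ₗ (TensorProduct.comm ℝ V V).toLinearMap = counit
  zigzag : (TensorProduct.lid ℝ V).toLinearMap ∘ₗ counit.rTensor V ∘ₗ
      (TensorProduct.assoc ℝ V V V).symm.toLinearMap ∘ₗ unit.lTensor V ∘ₗ
      (TensorProduct.rid ℝ V).symm.toLinearMap = LinearMap.id

namespace DualityStructure

variable {V : Type*} [AddCommGroup V] [Module ℝ V]

/-- The trace `e ∘ i` of the duality structure, the value of `Y` on the loop. -/
def trace (𝒟 : DualityStructure V) : ℝ := 𝒟.counit (𝒟.unit 1)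

variable {ι : Type*} [DecidableEq ι]

/-- The factor contributed to a matrix coefficient by an arc, where `a` and `c` label the incoming
and outgoing points by basis vectors: an entry of the matrix of `e` for an arc between two incoming
points, a Kronecker delta for an arc running through, and an entry of the matrix `(i_{jk})`, given
by `i(1) = ∑ i_{jk} b_j ⊗ b_k`, for an arc between two outgoing points. -/
def weight (𝒟 : DualityStructure V) (b : Module.Basis ι ℝ V) {m n : ℕ}
    (a : Fin m → ι) (c : Fin n → ι) : Fin m ⊕ Fin n → Fin m ⊕ Fin n → ℝ
  | .inl j, .inl k => 𝒟.counit (b (a j) ⊗ₜ[ℝ] b (a k))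
  | .inl j, .inr k => if a j = c k then 1 else 0
  | .inr j, .inl k => if c j = a k then 1 else 0
  | .inr j, .inr k => (b.tensorProduct b).repr (𝒟.unit 1) (c j, c k)

/-- The matrix of `Y(φ)`: one factor for every arc (each arc is counted at its smaller endpoint)
and one factor `e ∘ i` for every loop. -/
def brauerMatrix (𝒟 : DualityStructure V) (b : Module.Basis ι ℝ V) {m n : ℕ}
    (φ : BrauerHom m n) : Matrix (Fin n → ι) (Fin m → ι) ℝ :=
  fun c a => 𝒟.trace ^ φ.loops *
    ∏ x : Fin m ⊕ Fin n, if toLex x < toLex (φ.strand x) then 𝒟.weight b a c x (φ.strand x) else 1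

/-- The tensor power `V^{⊗ n}`. -/
abbrev TPow (V : Type*) [AddCommGroup V] [Module ℝ V] (n : ℕ) : Type _ := ⨂[ℝ]^n V

/-- The strict tensor product of linear maps between tensor powers of `V`: the tensor product of
maps, read through the canonical identifications `V^{⊗ m} ⊗ V^{⊗ r} = V^{⊗ (m + r)}`. -/
def tensorHom {m n r s : ℕ} (y : TPow V m →ₗ[ℝ] TPow V n) (y' : TPow V r →ₗ[ℝ] TPow V s) :
    TPow V (m + r) →ₗ[ℝ] TPow V (n + s) :=
  TensorPower.mulEquiv.toLinearMap ∘ₗ TensorProduct.map y y' ∘ₗ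
    TensorPower.mulEquiv.symm.toLinearMap

theorem brauerMatrix_tensor (𝒟 : DualityStructure V) (b : Module.Basis ι ℝ V) {m n r s : ℕ}
    (φ : BrauerHom m n) (ψ : BrauerHom r s) (c : Fin n → ι) (c' : Fin s → ι)
    (a : Fin m → ι) (a' : Fin r → ι) :
    𝒟.brauerMatrix b (φ.tensor ψ) (Fin.append c c') (Fin.append a a') =
      𝒟.brauerMatrix b φ c a * 𝒟.brauerMatrix b ψ c' a' := by
  unfold brauerMatrix
  rw [← Equiv.prod_comp (BrauerHom.stackEquiv m n r s), Fintype.prod_sum_type]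
  have h1 : ∀ x, (φ.tensor ψ).strand (BrauerHom.stackEquiv m n r s (.inl x)) =
      BrauerHom.stackEquiv m n r s (.inl (φ.strand x)) := fun x => by
    simp [BrauerHom.tensor, Equiv.permCongr_apply]
  have h2 : ∀ x, (φ.tensor ψ).strand (BrauerHom.stackEquiv m n r s (.inr x)) =
      BrauerHom.stackEquiv m n r s (.inr (ψ.strand x)) := fun x => by
    simp [BrauerHom.tensor, Equiv.permCongr_apply]
  have e1 : ∀ x y, (if toLex (BrauerHom.stackEquiv m n r s (.inl x)) <
        toLex (BrauerHom.stackEquiv m n r s (.inl y)) then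
        𝒟.weight b (Fin.append a a') (Fin.append c c') (BrauerHom.stackEquiv m n r s (.inl x))
          (BrauerHom.stackEquiv m n r s (.inl y)) else 1) =
      if toLex x < toLex y then 𝒟.weight b a c x y else 1 := by
    rintro (x | x) (y | y) <;> simp [BrauerHom.stackEquiv, weight, (Fin.strictMono_castAdd _).lt_iff_lt]
  have e2 : ∀ x y, (if toLex (BrauerHom.stackEquiv m n r s (.inr x)) <
        toLex (BrauerHom.stackEquiv m n r s (.inr y)) then
        𝒟.weight b (Fin.append a a') (Fin.append c c') (BrauerHom.stackEquiv m n r s (.inr x))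
          (BrauerHom.stackEquiv m n r s (.inr y)) else 1) =
      if toLex x < toLex y then 𝒟.weight b a' c' x y else 1 := by
    rintro (x | x) (y | y) <;> simp [BrauerHom.stackEquiv, weight]
  simp only [h1, h2, e1, e2]
  simp only [BrauerHom.tensor, pow_add]
  ring

variable [Module.Finite ℝ V]

/-- The basis of `V^{⊗ n}` formed by the tensor products of basis vectors of `V`. -/
def powBasis (V : Type*) [AddCommGroup V] [Module ℝ V] [Module.Finite ℝ V] (n : ℕ) :
    Module.Basis (Fin n → Fin (Module.finrank ℝ V)) ℝ (TPow V n) :=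
  Basis.piTensorProduct fun _ => Module.finBasis ℝ V

/-- The symmetric strict monoidal functor `Y` from the Brauer category to vector spaces with
`Y([1]) = V`, `Y(i_1) = i` and `Y(e_1) = e`, on morphisms. -/
def rep (𝒟 : DualityStructure V) {m n : ℕ} (φ : BrauerHom m n) : TPow V m →ₗ[ℝ] TPow V n :=
  Matrix.toLin (powBasis V m) (powBasis V n) (𝒟.brauerMatrix (Module.finBasis ℝ V) φ)

theorem rep_tensor (𝒟 : DualityStructure V) {m n r s : ℕ}
    (φ : BrauerHom m n) (ψ : BrauerHom r s) :
    𝒟.rep (φ.tensor ψ) = tensorHom (𝒟.rep φ) (𝒟.rep ψ) := by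
  have key : ∀ (k l : ℕ) (a : Fin k → Fin (Module.finrank ℝ V)) (a' : Fin l → _),
      TensorPower.mulEquiv (powBasis V k a ⊗ₜ[ℝ] powBasis V l a') =
        powBasis V (k + l) (Fin.append a a') := by
    intro k l a a'
    simp only [powBasis, Basis.piTensorProduct_apply]
    rw [← TensorPower.gMul_def]
    refine (TensorPower.tprod_mul_tprod ℝ _ _).trans ?_
    congr 1
    ext j
    refine Fin.addCases (fun i => ?_) (fun i => ?_) j <;> simp
  unfold tensorHom
  rw [← LinearMap.comp_assoc, LinearEquiv.eq_comp_toLinearMap_symm]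
  refine ((powBasis V m).tensorProduct (powBasis V r)).ext fun ⟨a, a'⟩ => ?_
  simp only [Module.Basis.tensorProduct_apply, LinearMap.comp_apply, LinearEquiv.coe_coe, key,
    TensorProduct.map_tmul]
  simp only [rep, Matrix.toLin_self]
  rw [← Equiv.sum_comp (Fin.appendEquiv n s), Fintype.sum_prod_type,
    TensorProduct.sum_tmul, map_sum]
  refine Finset.sum_congr rfl fun c _ => ?_
  rw [TensorProduct.tmul_sum, map_sum]
  refine Finset.sum_congr rfl fun c' _ => ?_
  rw [TensorProduct.smul_tmul_smul, map_smul, key]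
  simp only [Fin.appendEquiv, Equiv.coe_fn_mk]
  rw [brauerMatrix_tensor]

theorem rep_addLoop (𝒟 : DualityStructure V) {m n : ℕ} (φ : BrauerHom m n) :
    𝒟.rep φ.addLoop = 𝒟.trace • 𝒟.rep φ := by
  unfold rep
  rw [← map_smul]
  congr 1
  ext c a
  simp [brauerMatrix, BrauerHom.addLoop, pow_succ]
  ring


/-- `Y` is faithful on loops. -/
def LoopFaithful (𝒟 : DualityStructure V) : Prop :=
  ∀ (m n : ℕ) (φ ψ : BrauerHom m n), 𝒟.rep φ = 𝒟.rep ψ → φ.loops = ψ.loops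

/-! ### The profinite idempotent completion `Q` -/

/-- `H_{m,n} = Y(Hom([m], [n]))`. -/
def homSet (𝒟 : DualityStructure V) (m n : ℕ) : Set (TPow V m →ₗ[ℝ] TPow V n) :=
  Set.range fun φ : BrauerHom m n => 𝒟.rep φ

/-- The action of `τ` on `H_{m,n}`: multiplication by the trace. -/
def homScale (𝒟 : DualityStructure V) (m n : ℕ) (h : 𝒟.homSet m n) : 𝒟.homSet m n :=
  ⟨𝒟.trace • h.1, by
    obtain ⟨φ, hφ⟩ := h.2
    exact ⟨φ.addLoop, by rw [← hφ]; exact 𝒟.rep_addLoop φ⟩⟩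

/-- The tensor product `H_{m,n} × H_{r,s} → H_{m+r,n+s}`. -/
def homTensor (𝒟 : DualityStructure V) {m n r s : ℕ} (y : 𝒟.homSet m n) (y' : 𝒟.homSet r s) :
    𝒟.homSet (m + r) (n + s) :=
  ⟨tensorHom y.1 y'.1, by
    obtain ⟨φ, hφ⟩ := y.2
    obtain ⟨ψ, hψ⟩ := y'.2
    exact ⟨φ.tensor ψ, by rw [← hφ, ← hψ]; exact 𝒟.rep_tensor φ ψ⟩⟩

/-- The free commutative monoid on `H_{m,n}`, as a semimodule over `ℕ[τ]`. -/
abbrev FreeMod (𝒟 : DualityStructure V) (m n : ℕ) : Type _ :=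
  Module.AEval' (Finsupp.lmapDomain ℕ ℕ (𝒟.homScale m n))

/-- `Q(H_{m,n})`, the tensor product over `ℕ[τ]` of the free commutative monoid on `H_{m,n}` with
`𝔹⟦q⟧`, on which `τ` acts as `q`. -/
def QH (𝒟 : DualityStructure V) (m n : ℕ) : Type _ :=
  𝒟.FreeMod m n ⊗[Polynomial ℕ] PowerSeries BoolSemiring

instance (𝒟 : DualityStructure V) (m n : ℕ) : AddCommMonoid (𝒟.QH m n) :=
  inferInstanceAs (AddCommMonoid (𝒟.FreeMod m n ⊗[Polynomial ℕ] PowerSeries BoolSemiring))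

instance (𝒟 : DualityStructure V) (m n : ℕ) : Module (Polynomial ℕ) (𝒟.QH m n) :=
  inferInstanceAs (Module (Polynomial ℕ) (𝒟.FreeMod m n ⊗[Polynomial ℕ] PowerSeries BoolSemiring))

/-- The element `h ⊗ b` of `Q(H_{m,n})`. -/
def elem (𝒟 : DualityStructure V) {m n : ℕ} (h : 𝒟.homSet m n) (b : PowerSeries BoolSemiring) :
    𝒟.QH m n :=
  Module.AEval'.of _ (Finsupp.single h 1) ⊗ₜ[Polynomial ℕ] b

/-- The set of all `Y(φ)` with `φ : [m] → [n]` loop-free, as a subset of `H_{m,n}`. If `Y` is faithful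
on loops, this is the minimal shell of `H_{m,n}`: the elements `y` that are not of the form
`trace ^ k • y₀` with `k > 0` and `y₀ ∈ H_{m,n}`. -/
def openSet (𝒟 : DualityStructure V) (m n : ℕ) : Set (𝒟.homSet m n) :=
  {h | ∃ φ : BrauerHom m n, φ.loops = 0 ∧ 𝒟.rep φ = h.1}

instance (𝒟 : DualityStructure V) (m n : ℕ) : Finite (𝒟.openSet m n) := by
  have : Function.Injective fun h : 𝒟.openSet m n => (Classical.choose h.2).strand := by
    intro h h' hh
    have e := Classical.choose_spec h.2
    have e' := Classical.choose_spec h'.2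
    have : Classical.choose h.2 = Classical.choose h'.2 := BrauerHom.ext hh (e.1.trans e'.1.symm)
    exact Subtype.ext (Subtype.ext (by rw [← e.2, ← e'.2, this]))
  exact Finite.of_injective _ this

instance (𝒟 : DualityStructure V) (m n : ℕ) : Fintype (𝒟.openSet m n) := Fintype.ofFinite _

/-- The element `∑_y y ⊗ b_y`, where `y` runs through the images of loop-free morphisms. -/
def normalForm (𝒟 : DualityStructure V) (m n : ℕ)
    (b : 𝒟.openSet m n → PowerSeries BoolSemiring) : 𝒟.QH m n :=
  ∑ y : 𝒟.openSet m n, 𝒟.elem y.1 (b y)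

/-- The coefficients `b_y` of an element `∑_y y ⊗ b_y` of `Q(H_{m,n})`. They exist and are unique
(that is, `normalForm` is bijective) as soon as `Y` is faithful on loops. -/
def coords (𝒟 : DualityStructure V) {m n : ℕ} :
    𝒟.QH m n → 𝒟.openSet m n → PowerSeries BoolSemiring :=
  Function.invFun (𝒟.normalForm m n)

/-- The summation law of `Q(H_{m,n})`:
`∑_i (∑_y y ⊗ b_{y,i}) = ∑_y y ⊗ (∑_i b_{y,i})`. -/
def QH.isum (𝒟 : DualityStructure V) {m n : ℕ} {ι : Type*} (f : ι → 𝒟.QH m n) : 𝒟.QH m n :=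
  𝒟.normalForm m n fun y => seriesSum fun i => 𝒟.coords (f i) y

/-- The product `Q(H_{m,n}) × Q(H_{r,s}) → Q(H_{m+r,n+s})` that comes from the tensor product:
`f × f' = ∑_{y,y'} (y ⊗ y') ⊗ (b_y b'_{y'})`. -/
def QH.times (𝒟 : DualityStructure V) {m n r s : ℕ} (f : 𝒟.QH m n) (f' : 𝒟.QH r s) :
    𝒟.QH (m + r) (n + s) :=
  ∑ y : 𝒟.openSet m n, ∑ y' : 𝒟.openSet r s,
    𝒟.elem (𝒟.homTensor y.1 y'.1) (𝒟.coords f y * 𝒟.coords f' y')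

/-- The identity map `Q(H_{m,n}) = Q(H_{m',n'})` for `m = m'` and `n = n'`. -/
def QH.recast (𝒟 : DualityStructure V) {m n m' n' : ℕ} (hm : m = m') (hn : n = n')
    (f : 𝒟.QH m n) : 𝒟.QH m' n' :=
  hm ▸ hn ▸ f

/-- The profinite idempotent completion `Q = ∏_{m,n} Q(H_{m,n})` of `Y(Mor(Br))`. -/
def Q (𝒟 : DualityStructure V) : Type _ := ∀ m n : ℕ, 𝒟.QH m n

instance (𝒟 : DualityStructure V) : AddCommMonoid 𝒟.Q :=
  inferInstanceAs (AddCommMonoid (∀ m n : ℕ, 𝒟.QH m n))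

/-- The summation law of `Q`, componentwise. -/
def Q.isum (𝒟 : DualityStructure V) {ι : Type*} (f : ι → 𝒟.Q) : 𝒟.Q :=
  fun m n => QH.isum 𝒟 fun i => f i m n

/-- The multiplication `×` of the monoidal semiring `Q^m`:
`(f × f')_{m,n}` is the sum of all `f_{p,q} × f'_{r,s}` with `p + r = m` and `q + s = n`. -/
def Q.times (𝒟 : DualityStructure V) (f f' : 𝒟.Q) : 𝒟.Q := fun m n =>
  ∑ u ∈ (Finset.HasAntidiagonal.antidiagonal m).attach, ∑ v ∈ (Finset.HasAntidiagonal.antidiagonal n).attach,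
    QH.recast 𝒟 (Finset.HasAntidiagonal.mem_antidiagonal.1 u.2) (Finset.HasAntidiagonal.mem_antidiagonal.1 v.2)
      (QH.times 𝒟 (f u.1.1 v.1.1) (f' u.1.2 v.1.2))

/-- The element `Y(φ) ⊗ 1` of `Q(H_{m,n})`, regarded as an element of `Q`. -/
def ofMor (𝒟 : DualityStructure V) (φ : BrauerMor) : 𝒟.Q :=
  Pi.single (M := fun m => ∀ n, 𝒟.QH m n) φ.dom
    (Pi.single (M := fun n => 𝒟.QH φ.dom n) φ.cod (𝒟.elem ⟨𝒟.rep φ.hom, φ.hom, rfl⟩ 1))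

end DualityStructure

/-! ### Embedded manifolds -/

section Manifolds

variable {E H : Type*} [NormedAddCommGroup E] [NormedSpace ℝ E]
  [NormedAddCommGroup H] [NormedSpace ℝ H]

/-- The tangent space at `x` of an embedded submanifold `X` (possibly with boundary) of a normed
space, as a subspace of the ambient space. -/
def tanSpace (X : Set E) (x : E) : Submodule ℝ E := Submodule.span ℝ (tangentConeAt ℝ X x)

/-- `f` is smooth on the subset `X`: near each point of `X` it extends to a smooth function on an open
set of the ambient space. -/
def SmoothOn (f : E → ℂ) (X : Set E) : Prop :=
  ∀ x ∈ X, ∃ (U : Set E) (g : E → ℂ), IsOpen U ∧ x ∈ U ∧ ContDiffOn ℝ ∞ g U ∧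
    Set.EqOn f g (X ∩ U)

/-- `φ` restricts to a smooth embedding of `O` onto a relatively open subset of `X`. It is used for
`O` open in `H`, or open in a closed half-space of `H`. -/
structure IsParam (X : Set E) (O : Set H) (φ : H → E) : Prop where
  smooth : ContDiffOn ℝ ∞ φ O
  immersion : ∀ u ∈ O, Function.Injective (fderivWithin ℝ φ O u)
  embedding : Topology.IsEmbedding (O.domRestrict φ)
  image : ∃ U : Set E, IsOpen U ∧ φ '' O = X ∩ U

end Manifolds

/-- `ℝ^D = ℝ × ℝ^{D-1}`. -/
abbrev Space (D : ℕ) : Type := ℝ × EuclideanSpace ℝ (Fin (D - 1))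

/-- `ℝ × ℝ^D`, with time as the first coordinate. -/
abbrev Spacetime (D : ℕ) : Type := ℝ × Space D

/-- `ℝ^n = ℝ × ℝ^{n-1}`, the model of `n`-manifolds; with boundary the model is the half-space on
which the first coordinate is nonnegative. -/
abbrev Model (n : ℕ) : Type := ℝ × EuclideanSpace ℝ (Fin (n - 1))

/-- A subset of the half-space of `ℝ^n` that is open in the half-space. -/
def IsOpenHalf (n : ℕ) (O : Set (Model n)) : Prop :=
  ∃ U : Set (Model n), IsOpen U ∧ O = U ∩ {u | 0 ≤ u.1}

variable {D : ℕ}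

/-- `M` is a closed `(n-1)`-manifold, smoothly embedded in `ℝ^D` so that every component lies in some
slice `{k} × ℝ^{D-1}`, `k ∈ ℕ`. -/
structure IsClosedManifold (n : ℕ) (M : Set (Space D)) : Prop where
  compact : IsCompact M
  chart : ∀ x ∈ M, ∃ (O : Set (EuclideanSpace ℝ (Fin (n - 1))))
    (φ : EuclideanSpace ℝ (Fin (n - 1)) → Space D), IsOpen O ∧ IsParam M O φ ∧ x ∈ φ '' O
  slices : ∀ x ∈ M, ∃ k : ℕ, connectedComponentIn M x ⊆ {y | y.1 = k}

/-- The boundary of an embedded `n`-manifold with boundary. -/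
def bdry (n : ℕ) (W : Set (Spacetime D)) : Set (Spacetime D) :=
  {x | ∃ (O : Set (Model n)) (φ : Model n → Spacetime D), IsOpenHalf n O ∧ IsParam W O φ ∧
    ∃ u ∈ O, u.1 = 0 ∧ φ u = x}

/-- `ε` is a cylinder scale of the cobordism `W` from `M` to `N`. -/
structure IsCylinderScale (M N : Set (Space D)) (W : Set (Spacetime D)) (ε : ℝ) : Prop where
  pos : 0 < ε
  lt_half : ε < 1 / 2
  incoming : W ∩ Set.Icc 0 ε ×ˢ Set.univ = Set.Icc 0 ε ×ˢ M
  outgoing : W ∩ Set.Icc (1 - ε) 1 ×ˢ Set.univ = Set.Icc (1 - ε) 1 ×ˢ N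

/-- `W ⊆ [0,1] × ℝ^D` is an `n`-dimensional cobordism from `M` to `N`. -/
structure IsCobordism (n : ℕ) (M N : Set (Space D)) (W : Set (Spacetime D)) : Prop where
  closed_in : IsClosedManifold n M
  closed_out : IsClosedManifold n N
  compact : IsCompact W
  chart : ∀ x ∈ W, ∃ (O : Set (Model n)) (φ : Model n → Spacetime D),
    IsOpenHalf n O ∧ IsParam W O φ ∧ x ∈ φ '' O
  subset : W ⊆ Set.Icc 0 1 ×ˢ Set.univ
  bdry_eq : bdry n W = {0} ×ˢ M ∪ {1} ×ˢ N
  interior_subset : W \ bdry n W ⊆ Set.Ioo 0 1 ×ˢ Set.univ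
  cylinder : ∃ ε, IsCylinderScale M N W ε
  slices : ∀ x ∈ W, ∃ k : ℕ, connectedComponentIn W x ⊆ {y | y.2.1 = k}

/-- The part `W(k)` of `W` in the slice `[0,1] × {k} × ℝ^{D-1}`. -/
def slice (W : Set (Spacetime D)) (k : ℕ) : Set (Spacetime D) := {x ∈ W | x.2.1 = k}

/-- The time slice `W_t`. -/
def timeSlice (W : Set (Spacetime D)) (t : ℝ) : Set (Spacetime D) := {x ∈ W | x.1 = t}

/-- The regular values in `[0,1]` of the time function of `W`. -/
def regularTimes (W : Set (Spacetime D)) : Set ℝ :=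
  {t ∈ Set.Icc 0 1 | ∀ x ∈ timeSlice W t, ∃ v ∈ tanSpace W x, v.1 ≠ 0}

/-! ### Fold fields

A map `F : W → ℂ` is studied through a function `f` on the ambient space that agrees with it on `W`;
all notions depend on the values of `f` on `W` only. -/

/-- The rank of the differential `T_x W → ℂ` of `f` at a point `x` of `W`. -/
def rankAt (f : Spacetime D → ℂ) (W : Set (Spacetime D)) (x : Spacetime D) : ℕ :=
  Module.finrank ℝ ((tanSpace W x).map (fderivWithin ℝ f W x).toLinearMap)

/-- The singular set `S(F)`. -/
def singularSet (f : Spacetime D → ℂ) (W : Set (Spacetime D)) : Set (Spacetime D) :=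
  {x ∈ W | rankAt f W x < 2}

/-- The set of `1`-jets of maps from (subsets of) `ℝ^n`, `n ≥ 2`, to `ℂ` that have corank `1`. -/
def jetStratum (n : ℕ) : Set (Model n × ℂ × (Model n →L[ℝ] ℂ)) :=
  {σ | Module.finrank ℝ (LinearMap.range σ.2.2.toLinearMap) = 1}

/-- The `1`-jet extension of a map `g` on `O`. -/
def jet {n : ℕ} (g : Model n → ℂ) (O : Set (Model n)) (u : Model n) :
    Model n × ℂ × (Model n →L[ℝ] ℂ) :=
  (u, g u, fderivWithin ℝ g O u)

/-- The map `f` on the `n`-manifold `W` is a fold map: its `1`-jet extension, expressed in local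
parametrizations of `W`, is transverse to the corank-one stratum `S_1`; all singular points have
corank one; and `T_x S(F) + ker D_x F = T_x W` for every `x ∈ S(F)`. -/
structure IsFoldMap (n : ℕ) (f : Spacetime D → ℂ) (W : Set (Spacetime D)) : Prop where
  smooth : SmoothOn f W
  transverse : ∀ (O : Set (Model n)) (φ : Model n → Spacetime D), IsOpenHalf n O → IsParam W O φ →
    ∀ u ∈ O, jet (f ∘ φ) O u ∈ jetStratum n →
      LinearMap.range (fderivWithin ℝ (jet (f ∘ φ) O) O u).toLinearMap ⊔
        tanSpace (jetStratum n) (jet (f ∘ φ) O u) = ⊤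
  corank_one : ∀ x ∈ singularSet f W, rankAt f W x = 1
  no_cusp : ∀ x ∈ singularSet f W,
    tanSpace (singularSet f W) x ⊔
      (tanSpace W x ⊓ LinearMap.ker (fderivWithin ℝ f W x).toLinearMap) = tanSpace W x

/-- `GenIm(F)`: the times over which `F` has generic imaginary parts. -/
def genIm (f : Spacetime D → ℂ) (W : Set (Spacetime D)) : Set ℝ :=
  {t ∈ Set.Icc 0 1 | Set.InjOn (fun x => (f x).im) (timeSlice (singularSet f W) t)}

/-- `⋔(F)`: the regular times `t` for which `S(F)` is transverse to `W_t` in `W`. -/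
def transverseTimes (f : Spacetime D → ℂ) (W : Set (Spacetime D)) : Set ℝ :=
  {t ∈ regularTimes W | ∀ x ∈ timeSlice (singularSet f W) t,
    tanSpace (singularSet f W) x ⊔ tanSpace (timeSlice W t) x = tanSpace W x}

/-- `f` is a fold field on `W`. -/
structure IsFoldField (n : ℕ) (f : Spacetime D → ℂ) (W : Set (Spacetime D)) : Prop where
  fold : IsFoldMap n f W
  ends : ∀ k : ℕ, (slice W k).Nonempty → ∀ t ∈ ({0, 1} : Set ℝ),
    t ∈ transverseTimes f (slice W k) ∩ genIm f (slice W k)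
  generic : ∀ k : ℕ, (slice W k).Nonempty →
    {t : Set.Icc (0 : ℝ) 1 | (t : ℝ) ∈ genIm f (slice W k)} ∈ residual (Set.Icc (0 : ℝ) 1)

/-- The extension by zero of a function on a subset of spacetime. -/
def extendZero {W : Set (Spacetime D)} (F : W → ℂ) : Spacetime D → ℂ :=
  open scoped Classical in fun x => if h : x ∈ W then F ⟨x, h⟩ else 0

/-- The set `𝓕(W)` of fold fields on `W`. (For `W = ∅` it has exactly one element.) -/
def FoldField (n : ℕ) (W : Set (Spacetime D)) : Type :=
  {F : W → ℂ // IsFoldField n (extendZero F) W}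

/-- A fold field as a function on spacetime, zero outside its domain. -/
def FoldField.fn {n : ℕ} {W : Set (Spacetime D)} (F : FoldField n W) : Spacetime D → ℂ :=
  extendZero F.1

/-! ### The action functional -/

/-- `φ` is the Brauer morphism of the field `f` on `W`, for `W` contained in a single slice.
The points of `S(F)` at time `0` and at time `1` are numbered by increasing imaginary part of `F`
(`p` and `q`); two of these points are joined in `φ` exactly if they are the endpoints of the same
component of `S(F)`, and `φ` has one loop for each component without endpoints. -/
def IsBrauerOf (f : Spacetime D → ℂ) (W : Set (Spacetime D)) (φ : BrauerMor) : Prop :=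
  ∃ (p : Fin φ.dom → Spacetime D) (q : Fin φ.cod → Spacetime D),
    Set.range p = timeSlice (singularSet f W) 0 ∧
    Set.range q = timeSlice (singularSet f W) 1 ∧
    StrictMono (fun i => (f (p i)).im) ∧ StrictMono (fun j => (f (q j)).im) ∧
    (∀ x y : Fin φ.dom ⊕ Fin φ.cod, φ.hom.strand x = y ↔
      x ≠ y ∧ Sum.elim p q y ∈ connectedComponentIn (singularSet f W) (Sum.elim p q x)) ∧
    φ.hom.loops = Set.ncard {c : Set (Spacetime D) |
      ∃ x ∈ singularSet f W, c = connectedComponentIn (singularSet f W) x ∧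
        ∀ y ∈ c, y.1 ≠ 0 ∧ y.1 ≠ 1}

/-- The Brauer morphism of a field on a cobordism contained in a single slice; it is `1_[0]` on the
empty cobordism. For a fold field there is exactly one morphism as in `IsBrauerOf`, since `S(F)` is
then a compact `1`-manifold whose boundary is its set of points at times `0` and `1`. -/
def sliceAction (f : Spacetime D → ℂ) (W : Set (Spacetime D)) : BrauerMor :=
  open scoped Classical in
  if h : W.Nonempty ∧ ∃ φ, IsBrauerOf f W φ then h.2.choose else BrauerMor.identity 0

/-- The tensor product `𝕊(F(0)) ⊗ ⋯ ⊗ 𝕊(F(K-1))`. -/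
def actionBelow (f : Spacetime D → ℂ) (W : Set (Spacetime D)) : ℕ → BrauerMor
  | 0 => BrauerMor.identity 0
  | K + 1 => (actionBelow f W K).tensor (sliceAction f (slice W K))

/-- The action functional `𝕊(F) = ⨂_k 𝕊(F(k))`. The product stops at the least `K` beyond which all
`W(k)` are empty. -/
def action {n : ℕ} {W : Set (Spacetime D)} (F : FoldField n W) : BrauerMor :=
  actionBelow F.fn W (sInf {K : ℕ | ∀ k ≥ K, slice W k = ∅})

/-! ### State modules and state sums -/

/-- The set `𝓕(M)` of fields on a closed manifold `M`: the fold fields on the cylinder `[0,1] × M`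
whose Brauer morphism is an identity. -/
def ClosedField (n : ℕ) (M : Set (Space D)) : Type :=
  {f : FoldField n (Set.Icc (0 : ℝ) 1 ×ˢ M) // (action f).IsIdentity}

/-- A field on `M` as a function on spacetime, zero outside `[0,1] × M`. -/
def ClosedField.fn {n : ℕ} {M : Set (Space D)} (f : ClosedField n M) : Spacetime D → ℂ := f.1.fn

/-- `f` on `[a,b] × X` and `f'` on `[a',b'] × X` are equivalent: `f(t,x) = f'(ξ(t),x)` for a
diffeomorphism `ξ : [a,b] → [a',b']` with `ξ(a) = a'`. -/
def Approx (a b : ℝ) (f : Spacetime D → ℂ) (a' b' : ℝ) (f' : Spacetime D → ℂ)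
    (X : Set (Space D)) : Prop :=
  ∃ ξ η : ℝ → ℝ, ContDiffOn ℝ ∞ ξ (Set.Icc a b) ∧ ContDiffOn ℝ ∞ η (Set.Icc a' b') ∧
    Set.MapsTo ξ (Set.Icc a b) (Set.Icc a' b') ∧ Set.MapsTo η (Set.Icc a' b') (Set.Icc a b) ∧
    Set.InvOn η ξ (Set.Icc a b) (Set.Icc a' b') ∧ ξ a = a' ∧
    ∀ t ∈ Set.Icc a b, ∀ x ∈ X, f (t, x) = f' (ξ t, x)

/-- The set `𝓕(W; f_M, f_N)` of fold fields on `W` that satisfy the boundary condition `(f_M, f_N)`,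
where `ε` is the cylinder scale of `W`. -/
def FieldsWithBoundary (n : ℕ) (W : Set (Spacetime D)) (ε : ℝ) {M N : Set (Space D)}
    (fM : ClosedField n M) (fN : ClosedField n N) : Set (FoldField n W) :=
  {F | ∀ k : ℕ, ∃ δ ∈ Set.Ioo 0 ε, ∃ δ' ∈ Set.Ioo 0 ε,
    Approx 0 δ F.fn 0 1 fM.fn {y ∈ M | y.1 = k} ∧
    Approx (1 - δ') 1 F.fn 0 1 fN.fn {y ∈ N | y.1 = k}}

section States

variable {V : Type*} [AddCommGroup V] [Module ℝ V] [Module.Finite ℝ V]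

/-- The module `Z(M) ⊗̂ Z(N)`, where `Z(M)` is the module of functions `𝓕(M) → Q`. Under the canonical
isomorphism `Fun(A) ⊗̂ Fun(B) ≅ Fun(A × B)` it is the module of functions `𝓕(M) × 𝓕(N) → Q`. -/
abbrev States (𝒟 : DualityStructure V) (n : ℕ) (M N : Set (Space D)) : Type _ :=
  ClosedField n M × ClosedField n N → 𝒟.Q

/-- The module `Z(M) ⊗̂ Z(M') ⊗̂ Z(N) ⊗̂ Z(N')`, likewise as a module of functions. -/
abbrev States₄ (𝒟 : DualityStructure V) (n : ℕ) (M M' N N' : Set (Space D)) : Type _ :=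
  ClosedField n M × ClosedField n M' × ClosedField n N × ClosedField n N' → 𝒟.Q

/-- The state sum `Z_W ∈ Z(M) ⊗̂ Z(N)` of a cobordism `W` from `M` to `N` with cylinder scale `ε`:
`Z_W(f_M, f_N) = ∑_{F ∈ 𝓕(W; f_M, f_N)} Y(𝕊(F))`, by the summation law of `Q`. -/
def stateSum (𝒟 : DualityStructure V) (n : ℕ) (M N : Set (Space D)) (W : Set (Spacetime D))
    (ε : ℝ) : States 𝒟 n M N :=
  fun f => DualityStructure.Q.isum 𝒟 fun F : FieldsWithBoundary n W ε f.1 f.2 =>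
    𝒟.ofMor (action F.1)

/-- The product `ζ ⊗̂_m ζ' ∈ Z(M) ⊗̂ Z(M') ⊗̂ Z(N) ⊗̂ Z(N')` of `ζ ∈ Z(M) ⊗̂ Z(N)` and
`ζ' ∈ Z(M') ⊗̂ Z(N')`, which uses the multiplication of the monoidal semiring `Q^m`. -/
def monoidalTensor (𝒟 : DualityStructure V) {n : ℕ} {M M' N N' : Set (Space D)}
    (ζ : States 𝒟 n M N) (ζ' : States 𝒟 n M' N') : States₄ 𝒟 n M M' N N' :=
  fun ⟨fM, fM', fN, fN'⟩ => DualityStructure.Q.times 𝒟 (ζ (fM, fN)) (ζ' (fM', fN'))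

/-- `j` sends a pair of fields `(f, f')` to the disjoint union `f ⊔ f'`: the field on `M ⊔ M'` that
restricts to `f` and to `f'`. -/
def IsDisjointUnionMap {n : ℕ} {M M' : Set (Space D)}
    (j : ClosedField n M × ClosedField n M' → ClosedField n (M ∪ M')) : Prop :=
  ∀ f f', Set.EqOn (j (f, f')).fn f.fn (Set.Icc (0 : ℝ) 1 ×ˢ M) ∧
    Set.EqOn (j (f, f')).fn f'.fn (Set.Icc (0 : ℝ) 1 ×ˢ M')

/-- The isomorphism `ρ` from `Z(M ⊔ M') ⊗̂ Z(N ⊔ N')` to `Z(M) ⊗̂ Z(M') ⊗̂ Z(N) ⊗̂ Z(N')`,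
`ρ(z)(f_M, f_M', f_N, f_N') = z(f_M ⊔ f_M', f_N ⊔ f_N')`, where the bijections `jM` and `jN` are given
by the disjoint union of fields. -/
def rho (𝒟 : DualityStructure V) {n : ℕ} {M M' N N' : Set (Space D)}
    (jM : ClosedField n M × ClosedField n M' ≃ ClosedField n (M ∪ M'))
    (jN : ClosedField n N × ClosedField n N' ≃ ClosedField n (N ∪ N')) :
    States 𝒟 n (M ∪ M') (N ∪ N') ≃+ States₄ 𝒟 n M M' N N' where
  toFun z := fun ⟨fM, fM', fN, fN'⟩ => z (jM (fM, fM'), jN (fN, fN'))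
  invFun z := fun ⟨f, g⟩ =>
    z ((jM.symm f).1, (jM.symm f).2, (jN.symm g).1, (jN.symm g).2)
  left_inv z := by
    funext ⟨f, g⟩
    simp
  right_inv z := by
    funext ⟨fM, fM', fN, fN'⟩
    simp
  map_add' _ _ := rfl

end States

end FoldTFT

end

/-! Every field on `W ∪ W'` is uniquely a disjoint union of a field on `W` and one on `W'`. The
boundary conditions split accordingly, and the action of the union is the tensor product of the
actions. As `Y` is monoidal, the claim reduces to an infinite distributive law: a sum of tensor
products over a product of index sets is the product of the two sums.

Algebra. Loop-faithfulness makes the trace nonzero and makes each element of `H_{m,n}` uniquely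
`trace ^ k • y` with `y` in `openSet` (`LoopFaithful.pow_smul_inj`). So `τ` acts freely with basis
`openSet`, and elements of `Q(H_{m,n})` correspond to subsets of `H_{m,n}` through `QH.supp`. Under
this dictionary, sums, even infinite ones, are unions, `Y(φ) ⊗ 1` is a singleton, and `×` is the
elementwise tensor product of two sets. The distributive law (`LoopFaithful.isum_tensor`) is then
the fact that an image of a product of unions is the union of the images.

Geometry. The second coordinate separates the two pieces by the disjoint open sets `lowerPart` and
`upperPart`. Tangent spaces, ranks, jets, charts and boundaries are local, so being a fold map can
be tested on each piece; conditions imposed slice by slice split because in each slice at most one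
piece is nonempty. This gives `isFoldField_union`, hence `FoldField.unionEquiv`, and
`action_unionEquiv`. For fields on closed manifolds one also needs that a tensor product of Brauer
morphisms is an identity only if both factors are (`BrauerMor.isIdentity_tensor`). -/

noncomputable section

namespace FoldTFT

/-! ### Power series over the Boolean semiring -/

namespace BoolSemiring

theorem eq_iff_eq_one_iff {a b : BoolSemiring} : a = b ↔ (a = 1 ↔ b = 1) := by
  revert a b; decide

theorem add_eq_one {a b : BoolSemiring} : a + b = 1 ↔ a = 1 ∨ b = 1 := by
  revert a b; decide

theorem mul_eq_one {a b : BoolSemiring} : a * b = 1 ↔ a = 1 ∧ b = 1 := by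
  revert a b; decide

theorem zero_ne_one : (0 : BoolSemiring) ≠ 1 := by decide

theorem sum_eq_one {ι : Type*} (s : Finset ι) (f : ι → BoolSemiring) :
    ∑ i ∈ s, f i = 1 ↔ ∃ i ∈ s, f i = 1 := by
  classical
  induction s using Finset.induction_on with
  | empty => simp [zero_ne_one]
  | insert a s ha ih => simp [Finset.sum_insert ha, add_eq_one, ih]

end BoolSemiring

/-- No cancellation is possible in `𝔹`, so a series is a set of exponents and the product is the
sumset. -/
theorem coeff_mul_eq_one (b c : PowerSeries BoolSemiring) (k : ℕ) :
    PowerSeries.coeff k (b * c) = 1 ↔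
      ∃ i j, i + j = k ∧ PowerSeries.coeff i b = 1 ∧ PowerSeries.coeff j c = 1 := by
  rw [PowerSeries.coeff_mul, BoolSemiring.sum_eq_one]
  simp [BoolSemiring.mul_eq_one]

theorem coeff_one_eq_one (k : ℕ) :
    PowerSeries.coeff k (1 : PowerSeries BoolSemiring) = 1 ↔ k = 0 := by
  rw [PowerSeries.coeff_one]
  split <;> simp_all [BoolSemiring.zero_ne_one]

theorem coeff_X_pow_eq_one (k l : ℕ) :
    PowerSeries.coeff k (PowerSeries.X ^ l : PowerSeries BoolSemiring) = 1 ↔ k = l := by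
  rw [PowerSeries.coeff_X_pow]
  split <;> simp_all [BoolSemiring.zero_ne_one]

theorem coeff_seriesSum_eq_one {ι : Type*} (b : ι → PowerSeries BoolSemiring) (k : ℕ) :
    PowerSeries.coeff k (seriesSum b) = 1 ↔ ∃ i, PowerSeries.coeff k (b i) = 1 := by
  classical
  simp only [seriesSum, PowerSeries.coeff_mk]
  split <;> simp_all [BoolSemiring.zero_ne_one]

theorem X_pow_smul_powerSeries (l : ℕ) (b : PowerSeries BoolSemiring) :
    (Polynomial.X ^ l : Polynomial ℕ) • b = PowerSeries.X ^ l * b := by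
  rw [Algebra.smul_def]
  simp [PowerSeries.algebraMap_apply']

/-! ### Normal forms in `Q(H_{m,n})` -/

/-- A Brauer morphism stripped of its loops. -/
def BrauerHom.unloop {m n : ℕ} (φ : BrauerHom m n) : BrauerHom m n := { φ with loops := 0 }

namespace DualityStructure

variable {V : Type*} [AddCommGroup V] [Module ℝ V] [Module.Finite ℝ V]
  {𝒟 : DualityStructure V} {m n r s : ℕ}

/-- Loops enter the matrix of `Y(φ)` only through the power of the trace. -/
theorem rep_eq_pow_smul (φ : BrauerHom m n) :
    𝒟.rep φ = 𝒟.trace ^ φ.loops • 𝒟.rep φ.unloop := by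
  unfold rep
  rw [← map_smul]
  congr 1
  ext c a
  simp [brauerMatrix, BrauerHom.unloop]

variable (𝒟) in
/-- The loop-free part of an element of `H_{m,n}`. -/
def homBase (h : 𝒟.homSet m n) : 𝒟.openSet m n :=
  ⟨⟨𝒟.rep h.2.choose.unloop, _, rfl⟩, _, rfl, rfl⟩

variable (𝒟) in
/-- The number of loops of an element of `H_{m,n}`. -/
def homLoops (h : 𝒟.homSet m n) : ℕ := h.2.choose.loops

theorem eq_homBase (h : 𝒟.homSet m n) : h.1 = 𝒟.trace ^ 𝒟.homLoops h • (𝒟.homBase h).1.1 := by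
  conv_lhs => rw [← h.2.choose_spec]
  exact rep_eq_pow_smul _

/-- With trace zero, one loop and two loops would both be sent to `0`, against faithfulness. -/
theorem LoopFaithful.trace_ne_zero (hY : 𝒟.LoopFaithful) : 𝒟.trace ≠ 0 := by
  intro h
  have := hY 0 0 (BrauerHom.identity 0).addLoop (BrauerHom.identity 0).addLoop.addLoop (by
    simp [rep_addLoop, h])
  simp [BrauerHom.addLoop] at this

theorem LoopFaithful.loops_eq (hY : 𝒟.LoopFaithful) {k l : ℕ} {y z : 𝒟.openSet m n}
    (h : 𝒟.trace ^ k • y.1.1 = 𝒟.trace ^ l • z.1.1) : k = l := by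
  obtain ⟨φ, hφ, ey⟩ := y.2
  obtain ⟨ψ, hψ, ez⟩ := z.2
  rw [← ey, ← ez] at h
  have e : ∀ (χ : BrauerHom m n) (j : ℕ), χ.loops = 0 →
      𝒟.rep { χ with loops := j } = 𝒟.trace ^ j • 𝒟.rep χ := by
    intro χ j hχ
    rw [rep_eq_pow_smul]
    congr
    exact BrauerHom.ext rfl hχ.symm
  exact hY m n { φ with loops := k } { ψ with loops := l } ((e φ k hφ).trans (h.trans (e ψ l hψ).symm))

/-- The action of `τ` on `H_{m,n}` is free over `openSet`: faithfulness compares the exponents, and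
the nonzero scalar then cancels. All uniqueness of normal forms comes from here. -/
theorem LoopFaithful.pow_smul_inj (hY : 𝒟.LoopFaithful) {k l : ℕ} {y z : 𝒟.openSet m n}
    (h : 𝒟.trace ^ k • y.1.1 = 𝒟.trace ^ l • z.1.1) : k = l ∧ y = z := by
  obtain rfl := hY.loops_eq h
  exact ⟨rfl, Subtype.ext (Subtype.ext
    (smul_right_injective _ (pow_ne_zero k hY.trace_ne_zero) h))⟩

/-- `homLoops` and `homBase` come from an arbitrary choice of preimage; uniqueness of the
decomposition makes them independent of it. -/
theorem LoopFaithful.homScale_spec (hY : 𝒟.LoopFaithful) (h : 𝒟.homSet m n) :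
    𝒟.homLoops (𝒟.homScale m n h) = 𝒟.homLoops h + 1 ∧
      𝒟.homBase (𝒟.homScale m n h) = 𝒟.homBase h := by
  apply hY.pow_smul_inj
  rw [← eq_homBase, pow_succ', mul_smul, ← eq_homBase]
  rfl

open scoped Classical in
variable (𝒟 m n) in
/-- The coordinates of `h ⊗ b`, linearly in `b`. -/
def homCoord (h : 𝒟.homSet m n) :
    PowerSeries BoolSemiring →ₗ[Polynomial ℕ] (𝒟.openSet m n → PowerSeries BoolSemiring) :=
  (Polynomial.X ^ 𝒟.homLoops h : Polynomial ℕ) •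
    LinearMap.single (Polynomial ℕ) (fun _ => PowerSeries BoolSemiring) (𝒟.homBase h)

theorem LoopFaithful.homCoord_homScale (hY : 𝒟.LoopFaithful) (h : 𝒟.homSet m n) :
    homCoord 𝒟 m n (𝒟.homScale m n h) = (Polynomial.X : Polynomial ℕ) • homCoord 𝒟 m n h := by
  classical
  unfold homCoord
  rw [(hY.homScale_spec h).1, (hY.homScale_spec h).2, pow_succ']
  ext1 b
  exact mul_smul (Polynomial.X : Polynomial ℕ) (Polynomial.X ^ 𝒟.homLoops h)
    ((LinearMap.single (Polynomial ℕ) (fun _ => PowerSeries BoolSemiring) (𝒟.homBase h)) b)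

/-- The coordinate map of `Q(H_{m,n})`. -/
def LoopFaithful.coordMap (hY : 𝒟.LoopFaithful) (m n : ℕ) :
    𝒟.QH m n →ₗ[Polynomial ℕ] (𝒟.openSet m n → PowerSeries BoolSemiring) :=
  -- Descending to the tensor product over `ℕ[τ]` requires that `homScale` on generators become
  -- multiplication by `X`, which is `homCoord_homScale`.
  TensorProduct.lift (LinearMap.ofAEval (R := ℕ) (Finsupp.lmapDomain ℕ ℕ (𝒟.homScale m n))
    (Finsupp.linearCombination ℕ (homCoord 𝒟 m n)) (by
      intro f
      induction f using Finsupp.induction_linear with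
      | zero => simp
      | add f g hf hg => rw [smul_add, map_add, hf, hg, map_add, smul_add]
      | single h a =>
        simp only [Module.End.smul_def, Finsupp.lmapDomain_apply, Finsupp.mapDomain_single,
          Finsupp.linearCombination_single, hY.homCoord_homScale]
        rw [smul_comm]))

theorem LoopFaithful.coordMap_elem (hY : 𝒟.LoopFaithful) (h : 𝒟.homSet m n)
    (b : PowerSeries BoolSemiring) : hY.coordMap m n (𝒟.elem h b) = homCoord 𝒟 m n h b := by
  change (Finsupp.linearCombination ℕ (homCoord 𝒟 m n) (Finsupp.single h 1)) b = _
  simp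

theorem LoopFaithful.homLoops_open (hY : 𝒟.LoopFaithful) (y : 𝒟.openSet m n) :
    𝒟.homLoops y.1 = 0 ∧ 𝒟.homBase y.1 = y := by
  apply hY.pow_smul_inj
  rw [← eq_homBase, pow_zero, one_smul]

/-- The left inverse shows that `normalForm` is injective. -/
theorem LoopFaithful.coordMap_normalForm (hY : 𝒟.LoopFaithful)
    (b : 𝒟.openSet m n → PowerSeries BoolSemiring) :
    hY.coordMap m n (𝒟.normalForm m n b) = b := by
  classical
  unfold normalForm
  rw [map_sum]
  simp only [hY.coordMap_elem, homCoord, hY.homLoops_open]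
  ext1 y
  simp [Finset.sum_apply, Pi.single_apply]

theorem elem_add (h : 𝒟.homSet m n) (b c : PowerSeries BoolSemiring) :
    𝒟.elem h (b + c) = 𝒟.elem h b + 𝒟.elem h c := TensorProduct.tmul_add _ _ _

theorem elem_zero (h : 𝒟.homSet m n) : 𝒟.elem h 0 = 0 := TensorProduct.tmul_zero _ _

theorem normalForm_add (b c : 𝒟.openSet m n → PowerSeries BoolSemiring) :
    𝒟.normalForm m n (b + c) = 𝒟.normalForm m n b + 𝒟.normalForm m n c := by
  simp [normalForm, elem_add, Finset.sum_add_distrib]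

/-- `τ` moves across the tensor sign, where it becomes `q`. -/
theorem elem_homScale (h : 𝒟.homSet m n) (b : PowerSeries BoolSemiring) :
    𝒟.elem (𝒟.homScale m n h) b = 𝒟.elem h (PowerSeries.X * b) := by
  have := X_pow_smul_powerSeries 1 b
  rw [pow_one, pow_one] at this
  have e := TensorProduct.smul_tmul (R := Polynomial ℕ) (Polynomial.X : Polynomial ℕ)
    (Module.AEval'.of (Finsupp.lmapDomain ℕ ℕ (𝒟.homScale m n)) (Finsupp.single h 1)) b
  rw [Module.AEval'.X_smul_of, Finsupp.lmapDomain_apply, Finsupp.mapDomain_single, this] at e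
  exact e

theorem homScale_iterate (y : 𝒟.homSet m n) (k : ℕ) :
    ((𝒟.homScale m n)^[k] y).1 = 𝒟.trace ^ k • y.1 := by
  induction k with
  | zero => simp
  | succ k ih =>
    rw [Function.iterate_succ_apply', pow_succ', mul_smul, ← ih]
    rfl

theorem elem_iterate (h : 𝒟.homSet m n) (k : ℕ) (b : PowerSeries BoolSemiring) :
    𝒟.elem ((𝒟.homScale m n)^[k] h) b = 𝒟.elem h (PowerSeries.X ^ k * b) := by
  induction k generalizing b with
  | zero => simp
  | succ k ih =>
    rw [Function.iterate_succ_apply', elem_homScale, ih, pow_succ, mul_assoc]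

theorem elem_eq_homBase (h : 𝒟.homSet m n) (b : PowerSeries BoolSemiring) :
    𝒟.elem h b = 𝒟.elem (𝒟.homBase h).1 (PowerSeries.X ^ 𝒟.homLoops h * b) := by
  rw [← elem_iterate]
  congr 1
  exact Subtype.ext ((eq_homBase h).trans (homScale_iterate _ _).symm)

/-- Normal forms are closed under addition and contain every `elem h b`, since the loops of `h` can
be moved into the series; these elements generate. -/
theorem normalForm_surjective : Function.Surjective (𝒟.normalForm m n) := by
  classical
  have hz : ∃ b, 𝒟.normalForm m n b = 0 := ⟨0, by simp [normalForm, elem_zero]⟩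
  have ha : ∀ x y : 𝒟.QH m n, (∃ b, 𝒟.normalForm m n b = x) → (∃ b, 𝒟.normalForm m n b = y) →
      ∃ b, 𝒟.normalForm m n b = x + y := by
    rintro _ _ ⟨b, rfl⟩ ⟨c, rfl⟩
    exact ⟨b + c, normalForm_add b c⟩
  have he : ∀ (h : 𝒟.homSet m n) (b : PowerSeries BoolSemiring),
      ∃ c, 𝒟.normalForm m n c = 𝒟.elem h b := by
    intro h b
    refine ⟨Pi.single (𝒟.homBase h) (PowerSeries.X ^ 𝒟.homLoops h * b), ?_⟩
    rw [elem_eq_homBase, normalForm, Finset.sum_eq_single (𝒟.homBase h)]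
    · simp
    · intro y _ hy
      rw [Pi.single_eq_of_ne hy, elem_zero]
    · simp
  intro x
  refine TensorProduct.induction_on (motive := fun x : 𝒟.QH m n => ∃ b, 𝒟.normalForm m n b = x)
    x hz ?_ ha
  intro f b
  obtain ⟨f, rfl⟩ := (Module.AEval'.of (Finsupp.lmapDomain ℕ ℕ (𝒟.homScale m n))).surjective f
  induction f using Finsupp.induction_linear with
  | zero => rw [map_zero, TensorProduct.zero_tmul]; exact hz
  | add f g hf hg => rw [map_add, TensorProduct.add_tmul]; exact ha _ _ hf hg
  | single h a =>
    -- The multiplicity `a` is a natural number, so the generator occurs as an `a`-fold sum.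
    induction a with
    | zero => rw [Finsupp.single_zero, map_zero, TensorProduct.zero_tmul]; exact hz
    | succ a ih =>
      rw [Finsupp.single_add, map_add, TensorProduct.add_tmul]
      exact ha _ _ ih (he h b)

/-- Replaces the chosen inverse `coords` by a linear map, which makes it additive. -/
theorem LoopFaithful.coords_eq (hY : 𝒟.LoopFaithful) (x : 𝒟.QH m n) :
    𝒟.coords x = hY.coordMap m n x := by
  obtain ⟨b, rfl⟩ := normalForm_surjective x
  rw [hY.coordMap_normalForm]
  exact Function.leftInverse_invFun
    (Function.LeftInverse.injective (hY.coordMap_normalForm (m := m) (n := n))) b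

/-! ### Elements of `Q` as sets of morphisms -/

/-- The set of all `τ^k y` such that the coefficient of `q^k` in `b_y` is `1`. -/
def QH.supp (f : 𝒟.QH m n) : Set (𝒟.homSet m n) :=
  {h | ∃ (y : 𝒟.openSet m n) (k : ℕ), PowerSeries.coeff k (𝒟.coords f y) = 1 ∧
    h.1 = 𝒟.trace ^ k • y.1.1}

theorem LoopFaithful.mem_supp (hY : 𝒟.LoopFaithful) (f : 𝒟.QH m n) (h : 𝒟.homSet m n) :
    h ∈ QH.supp f ↔ PowerSeries.coeff (𝒟.homLoops h) (𝒟.coords f (𝒟.homBase h)) = 1 := by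
  constructor
  · rintro ⟨y, k, hk, e⟩
    rw [eq_homBase h] at e
    obtain ⟨rfl, rfl⟩ := hY.pow_smul_inj e
    exact hk
  · exact fun hk => ⟨_, _, hk, eq_homBase h⟩

/-- A pair consisting of a basis element `y` and an exponent `k` is the same as the element `τ^k y`
of `H_{m,n}`, so the support records every coefficient. -/
theorem LoopFaithful.supp_injective (hY : 𝒟.LoopFaithful) :
    Function.Injective (QH.supp : 𝒟.QH m n → Set (𝒟.homSet m n)) := by
  intro f g hfg
  obtain ⟨b, rfl⟩ := normalForm_surjective f
  obtain ⟨c, rfl⟩ := normalForm_surjective g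
  congr 1
  ext y k
  rw [BoolSemiring.eq_iff_eq_one_iff]
  -- Membership of `τ^k y` reads off the coefficient of `q^k` at `y`.
  have := Set.ext_iff.1 hfg ((𝒟.homScale m n)^[k] y.1)
  have e := homScale_iterate y.1 k
  rw [eq_homBase] at e
  obtain ⟨h1, h2⟩ := hY.pow_smul_inj e
  rw [hY.mem_supp, hY.mem_supp, h1, h2, hY.coords_eq, hY.coords_eq, hY.coordMap_normalForm,
    hY.coordMap_normalForm] at this
  exact this

theorem LoopFaithful.supp_add (hY : 𝒟.LoopFaithful) (f g : 𝒟.QH m n) :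
    QH.supp (f + g) = QH.supp f ∪ QH.supp g := by
  ext h
  rw [Set.mem_union, hY.mem_supp, hY.mem_supp, hY.mem_supp, hY.coords_eq, hY.coords_eq,
    hY.coords_eq, map_add, Pi.add_apply, map_add, BoolSemiring.add_eq_one]

theorem LoopFaithful.supp_zero (hY : 𝒟.LoopFaithful) : QH.supp (0 : 𝒟.QH m n) = ∅ := by
  ext h
  rw [hY.mem_supp, hY.coords_eq, map_zero]
  simp [BoolSemiring.zero_ne_one]

theorem LoopFaithful.mem_supp_sum (hY : 𝒟.LoopFaithful) {ι : Type*} (t : Finset ι)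
    (f : ι → 𝒟.QH m n) (h : 𝒟.homSet m n) :
    h ∈ QH.supp (∑ i ∈ t, f i) ↔ ∃ i ∈ t, h ∈ QH.supp (f i) := by
  classical
  induction t using Finset.induction_on with
  | empty => simp [hY.supp_zero]
  | insert a t ha ih => simp [Finset.sum_insert ha, hY.supp_add, ih]

theorem LoopFaithful.mem_supp_isum (hY : 𝒟.LoopFaithful) {ι : Type*} (f : ι → 𝒟.QH m n)
    (h : 𝒟.homSet m n) : h ∈ QH.supp (QH.isum 𝒟 f) ↔ ∃ i, h ∈ QH.supp (f i) := by
  simp only [hY.mem_supp, QH.isum]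
  rw [hY.coords_eq, hY.coordMap_normalForm, coeff_seriesSum_eq_one]

/-- Here `h` need not be loop-free: its own loops shift the exponents on both sides equally. -/
theorem LoopFaithful.mem_supp_elem (hY : 𝒟.LoopFaithful) (h g : 𝒟.homSet m n)
    (b : PowerSeries BoolSemiring) :
    g ∈ QH.supp (𝒟.elem h b) ↔ ∃ k, PowerSeries.coeff k b = 1 ∧ g.1 = 𝒟.trace ^ k • h.1 := by
  classical
  rw [hY.mem_supp, hY.coords_eq, hY.coordMap_elem, homCoord, LinearMap.smul_apply, Pi.smul_apply,
    X_pow_smul_powerSeries, coeff_mul_eq_one]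
  simp only [coeff_X_pow_eq_one, LinearMap.single_apply]
  constructor
  · rintro ⟨_, k, e, rfl, hk⟩
    by_cases hb : 𝒟.homBase g = 𝒟.homBase h
    · rw [hb, Pi.single_eq_same] at hk
      exact ⟨k, hk, by rw [eq_homBase g, eq_homBase h, hb, ← e, pow_add, mul_comm, mul_smul]⟩
    · rw [Pi.single_eq_of_ne hb] at hk
      exact absurd hk (by simp [BoolSemiring.zero_ne_one])
  · rintro ⟨k, hk, e⟩
    rw [eq_homBase g, eq_homBase h, ← mul_smul, ← pow_add] at e
    obtain ⟨h1, h2⟩ := hY.pow_smul_inj e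
    refine ⟨_, k, by rw [h1, add_comm], rfl, ?_⟩
    rw [h2, Pi.single_eq_same]
    exact hk

theorem LoopFaithful.supp_elem_one (hY : 𝒟.LoopFaithful) (h : 𝒟.homSet m n) :
    QH.supp (𝒟.elem h 1) = {h} := by
  ext g
  rw [hY.mem_supp_elem]
  simp only [coeff_one_eq_one, exists_eq_left, pow_zero, one_smul, Set.mem_singleton_iff, Subtype.ext_iff]

omit [Module.Finite ℝ V] in
theorem tensorHom_smul (a b : ℝ) (y : TPow V m →ₗ[ℝ] TPow V n) (y' : TPow V r →ₗ[ℝ] TPow V s) :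
    tensorHom (a • y) (b • y') = (a * b) • tensorHom y y' := by
  unfold tensorHom
  rw [TensorProduct.map_smul_left, TensorProduct.map_smul_right, smul_smul, LinearMap.smul_comp,
    LinearMap.comp_smul]

/-- Bilinearity gives `τ^i y ⊗ τ^j y' = τ^(i+j) (y ⊗ y')`, which matches the product of series. -/
theorem LoopFaithful.supp_times (hY : 𝒟.LoopFaithful) (f : 𝒟.QH m n) (f' : 𝒟.QH r s) :
    QH.supp (QH.times 𝒟 f f') = Set.image2 𝒟.homTensor (QH.supp f) (QH.supp f') := by
  ext h
  simp only [QH.times, hY.mem_supp_sum, hY.mem_supp_elem, coeff_mul_eq_one, Set.mem_image2]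
  constructor
  · rintro ⟨y, -, y', -, _, ⟨i, j, rfl, hi, hj⟩, e⟩
    refine ⟨_, ⟨y, i, hi, homScale_iterate y.1 i⟩, _, ⟨y', j, hj, homScale_iterate y'.1 j⟩,
      Subtype.ext ?_⟩
    rw [e]
    change tensorHom _ _ = _ • tensorHom _ _
    rw [homScale_iterate, homScale_iterate, tensorHom_smul, pow_add]
  · rintro ⟨g, ⟨y, i, hi, e⟩, g', ⟨y', j, hj, e'⟩, rfl⟩
    refine ⟨y, Finset.mem_univ _, y', Finset.mem_univ _, _, ⟨i, j, rfl, hi, hj⟩, ?_⟩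
    change tensorHom _ _ = _ • tensorHom _ _
    rw [e, e', tensorHom_smul, pow_add]

variable (𝒟) in
/-- The disjoint union of all `H_{m,n}`. -/
abbrev TotalHom : Type _ := Σ (m : ℕ) (n : ℕ), 𝒟.homSet m n

/-- The tensor product on the disjoint union of all `H_{m,n}`. -/
def TotalHom.tensor (x x' : 𝒟.TotalHom) : 𝒟.TotalHom :=
  ⟨x.1 + x'.1, x.2.1 + x'.2.1, 𝒟.homTensor x.2.2 x'.2.2⟩

variable (𝒟) in
/-- `Y(φ)` as an element of the disjoint union of all `H_{m,n}`. -/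
def totalRep (φ : BrauerMor) : 𝒟.TotalHom := ⟨φ.dom, φ.cod, 𝒟.rep φ.hom, φ.hom, rfl⟩

theorem totalRep_tensor (φ ψ : BrauerMor) :
    𝒟.totalRep (φ.tensor ψ) = (𝒟.totalRep φ).tensor (𝒟.totalRep ψ) := by
  have : (⟨𝒟.rep (φ.hom.tensor ψ.hom), _, rfl⟩ : 𝒟.homSet _ _) =
      𝒟.homTensor ⟨𝒟.rep φ.hom, _, rfl⟩ ⟨𝒟.rep ψ.hom, _, rfl⟩ :=
    Subtype.ext (rep_tensor 𝒟 _ _)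
  exact congrArg (fun h => (⟨_, _, h⟩ : 𝒟.TotalHom)) this

/-- The support of an element of `Q`. -/
def Q.supp (f : 𝒟.Q) : Set 𝒟.TotalHom := {x | x.2.2 ∈ QH.supp (f x.1 x.2.1)}

theorem LoopFaithful.Q_supp_injective (hY : 𝒟.LoopFaithful) :
    Function.Injective (Q.supp : 𝒟.Q → Set 𝒟.TotalHom) := by
  intro f g hfg
  funext m n
  apply hY.supp_injective
  ext h
  exact Set.ext_iff.1 hfg ⟨m, n, h⟩

theorem LoopFaithful.Q_supp_isum (hY : 𝒟.LoopFaithful) {ι : Type*} (f : ι → 𝒟.Q) :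
    Q.supp (Q.isum 𝒟 f) = ⋃ i, Q.supp (f i) := by
  ext x
  rw [Set.mem_iUnion]
  exact hY.mem_supp_isum _ _

theorem LoopFaithful.Q_supp_ofMor (hY : 𝒟.LoopFaithful) (φ : BrauerMor) :
    Q.supp (𝒟.ofMor φ) = {𝒟.totalRep φ} := by
  ext ⟨m, n, h⟩
  change h ∈ QH.supp (𝒟.ofMor φ m n) ↔ _ = _
  by_cases hm : m = φ.dom
  · subst hm
    by_cases hn : n = φ.cod
    · subst hn
      simp only [ofMor, Pi.single_eq_same, hY.supp_elem_one, totalRep]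
      simp
    · simp only [ofMor, Pi.single_eq_same, Pi.single_eq_of_ne hn, hY.supp_zero, totalRep]
      simp [hn]
  · simp only [ofMor, Pi.single_eq_of_ne hm, Pi.zero_apply, hY.supp_zero, totalRep]
    simp [hm]

/-- Equality in the sigma type `TotalHom` absorbs the transport along equalities of indices. -/
theorem mem_supp_recast {m' n' : ℕ} (hm : m = m') (hn : n = n') (f : 𝒟.QH m n)
    (h : 𝒟.homSet m' n') :
    h ∈ QH.supp (QH.recast 𝒟 hm hn f) ↔
      ∃ g ∈ QH.supp f, (⟨m, n, g⟩ : 𝒟.TotalHom) = ⟨m', n', h⟩ := by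
  subst hm hn
  simp [QH.recast]

/-- The sums over antidiagonals only sort the products by degree; on `TotalHom` they disappear. -/
theorem LoopFaithful.Q_supp_times (hY : 𝒟.LoopFaithful) (f f' : 𝒟.Q) :
    Q.supp (Q.times 𝒟 f f') = Set.image2 TotalHom.tensor (Q.supp f) (Q.supp f') := by
  ext ⟨m, n, h⟩
  change h ∈ QH.supp (Q.times 𝒟 f f' m n) ↔ _
  simp only [Q.times, hY.mem_supp_sum, mem_supp_recast, hY.supp_times, Set.mem_image2]
  constructor
  · rintro ⟨u, -, v, -, _, ⟨g, hg, g', hg', rfl⟩, e⟩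
    exact ⟨⟨_, _, g⟩, hg, ⟨_, _, g'⟩, hg', e⟩
  · rintro ⟨⟨p, q, g⟩, hg, ⟨r, s, g'⟩, hg', e⟩
    have hm : p + r = m := congrArg Sigma.fst e
    have hn : q + s = n := congrArg (fun x => x.2.1) e
    exact ⟨⟨(p, r), by simpa using hm⟩, by simp, ⟨(q, s), by simpa using hn⟩, by simp,
      _, ⟨g, hg, g', hg', rfl⟩, e⟩

/-- A sum of tensor products over a product set is the product of the sums. -/
theorem LoopFaithful.isum_tensor (hY : 𝒟.LoopFaithful) {ι κ l : Type*} (a : ι → BrauerMor)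
    (b : κ → BrauerMor) (c : l → BrauerMor) (e : ι × κ ≃ l)
    (h : ∀ i j, c (e (i, j)) = (a i).tensor (b j)) :
    Q.isum 𝒟 (fun x => 𝒟.ofMor (c x)) =
      Q.times 𝒟 (Q.isum 𝒟 fun i => 𝒟.ofMor (a i)) (Q.isum 𝒟 fun j => 𝒟.ofMor (b j)) := by
  apply hY.Q_supp_injective
  rw [hY.Q_supp_times]
  simp only [hY.Q_supp_isum, hY.Q_supp_ofMor]
  ext x
  simp only [Set.mem_iUnion, Set.mem_singleton_iff, Set.mem_image2, e.surjective.exists,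
    Prod.exists, h, totalRep_tensor]
  constructor
  · rintro ⟨i, j, rfl⟩
    exact ⟨_, ⟨i, rfl⟩, _, ⟨j, rfl⟩, rfl⟩
  · rintro ⟨_, ⟨i, rfl⟩, _, ⟨j, rfl⟩, rfl⟩
    exact ⟨i, j, rfl⟩

end DualityStructure

/-! ### Units and identities in the Brauer category -/

namespace BrauerHom

variable {m n r s : ℕ}

theorem tensor_strand_inl (φ : BrauerHom m n) (ψ : BrauerHom r s) (x : Fin m ⊕ Fin n) :
    (φ.tensor ψ).strand (stackEquiv m n r s (.inl x)) = stackEquiv m n r s (.inl (φ.strand x)) := by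
  simp [tensor, Equiv.permCongr_apply]

theorem tensor_strand_inr (φ : BrauerHom m n) (ψ : BrauerHom r s) (x : Fin r ⊕ Fin s) :
    (φ.tensor ψ).strand (stackEquiv m n r s (.inr x)) = stackEquiv m n r s (.inr (ψ.strand x)) := by
  simp [tensor, Equiv.permCongr_apply]

end BrauerHom

namespace BrauerMor

theorem ext_cast {φ ψ : BrauerMor} (hd : φ.dom = ψ.dom) (hc : φ.cod = ψ.cod)
    (hs : ∀ x, Sum.map (Fin.cast hd) (Fin.cast hc) (φ.hom.strand x) =
      ψ.hom.strand (Sum.map (Fin.cast hd) (Fin.cast hc) x))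
    (hl : φ.hom.loops = ψ.hom.loops) : φ = ψ := by
  obtain ⟨d, c, φ⟩ := φ
  obtain ⟨d', c', ψ⟩ := ψ
  obtain rfl : d = d' := hd
  obtain rfl : c = c' := hc
  congr 1
  refine BrauerHom.ext (Equiv.ext fun x => ?_) hl
  simpa using hs x

theorem tensor_identity_zero (φ : BrauerMor) : φ.tensor (identity 0) = φ := by
  obtain ⟨m, n, φ⟩ := φ
  have e : ∀ z, Sum.map (Fin.cast (Nat.add_zero m)) (Fin.cast (Nat.add_zero n))
      (BrauerHom.stackEquiv m n 0 0 (.inl z)) = z := by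
    rintro (z | z) <;> rfl
  refine ext_cast (Nat.add_zero m) (Nat.add_zero n) (fun x => ?_) (Nat.add_zero _)
  obtain ⟨y | y, rfl⟩ := (BrauerHom.stackEquiv m n 0 0).surjective x
  · refine (congrArg _ (BrauerHom.tensor_strand_inl φ (BrauerHom.identity 0) y)).trans ?_
    exact (e _).trans (congrArg φ.strand (e y)).symm
  · rcases y with y | y <;> exact y.elim0

theorem identity_zero_tensor (φ : BrauerMor) : (identity 0).tensor φ = φ := by
  obtain ⟨m, n, φ⟩ := φ
  have e : ∀ z, Sum.map (Fin.cast (Nat.zero_add m)) (Fin.cast (Nat.zero_add n))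
      (BrauerHom.stackEquiv 0 0 m n (.inr z)) = z := by
    rintro (z | z) <;> simp [BrauerHom.stackEquiv]
  refine ext_cast (Nat.zero_add m) (Nat.zero_add n) (fun x => ?_) (Nat.zero_add _)
  obtain ⟨y | y, rfl⟩ := (BrauerHom.stackEquiv 0 0 m n).surjective x
  · rcases y with y | y <;> exact y.elim0
  · refine (congrArg _ (BrauerHom.tensor_strand_inr (BrauerHom.identity 0) φ y)).trans ?_
    exact (e _).trans (congrArg φ.strand (e y)).symm

/-- It is enough to follow the incoming points, because the strand map is an involution. -/
theorem isIdentity_iff {m n : ℕ} (φ : BrauerHom m n) :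
    IsIdentity ⟨m, n, φ⟩ ↔ φ.loops = 0 ∧ m = n ∧
      ∀ i : Fin m, ∃ j : Fin n, φ.strand (.inl i) = .inr j ∧ (j : ℕ) = i := by
  constructor
  · rintro ⟨k, h⟩
    cases h
    exact ⟨rfl, rfl, fun i => ⟨i, rfl, rfl⟩⟩
  · rintro ⟨hl, rfl, h⟩
    have h1 : ∀ i, φ.strand (.inl i) = .inr i := by
      intro i
      obtain ⟨j, hj, e⟩ := h i
      rw [hj, Fin.ext e]
    refine ⟨m, congrArg (BrauerMor.mk m m) (BrauerHom.ext (Equiv.ext ?_) hl)⟩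
    rintro (i | i)
    · exact h1 i
    · have := φ.strand_strand (.inl i)
      rwa [h1] at this

/-- Arcs of a tensor product stay within their factor. The forward direction must exclude unequal
block sizes `m ≠ n`, although the totals agree. -/
theorem isIdentity_tensor (φ ψ : BrauerMor) :
    (φ.tensor ψ).IsIdentity ↔ φ.IsIdentity ∧ ψ.IsIdentity := by
  obtain ⟨m, n, φ⟩ := φ
  obtain ⟨r, s, ψ⟩ := ψ
  change IsIdentity ⟨m + r, n + s, φ.tensor ψ⟩ ↔ _
  rw [isIdentity_iff, isIdentity_iff, isIdentity_iff]
  have e1 : ∀ i : Fin m, (φ.tensor ψ).strand (.inl (Fin.castAdd r i)) =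
      BrauerHom.stackEquiv m n r s (.inl (φ.strand (.inl i))) := fun i => by
    rw [← BrauerHom.tensor_strand_inl φ ψ]; simp [BrauerHom.stackEquiv]
  have e2 : ∀ i : Fin r, (φ.tensor ψ).strand (.inl (Fin.natAdd m i)) =
      BrauerHom.stackEquiv m n r s (.inr (ψ.strand (.inl i))) := fun i => by
    rw [← BrauerHom.tensor_strand_inr φ ψ]; simp [BrauerHom.stackEquiv]
  constructor
  · rintro ⟨hl, hd, hs⟩
    have hl' : φ.loops + ψ.loops = 0 := hl
    have h1 : ∀ i : Fin m, ∃ j : Fin n, φ.strand (.inl i) = .inr j ∧ (j : ℕ) = i := by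
      intro i
      obtain ⟨j, hj, e⟩ := hs (Fin.castAdd _ i)
      rw [e1] at hj
      rcases h : φ.strand (.inl i) with z | z
      · simp [BrauerHom.stackEquiv, h] at hj
      · rw [h] at hj
        obtain rfl := Sum.inr_injective hj
        exact ⟨z, rfl, e⟩
    have h2 : ∀ i : Fin r, ∃ j : Fin s, ψ.strand (.inl i) = .inr j ∧ n + (j : ℕ) = m + i := by
      intro i
      obtain ⟨j, hj, e⟩ := hs (Fin.natAdd _ i)
      rw [e2] at hj
      rcases h : ψ.strand (.inl i) with z | z
      · simp [BrauerHom.stackEquiv, h] at hj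
      · rw [h] at hj
        obtain rfl := Sum.inr_injective hj
        exact ⟨z, rfl, e⟩
    -- If `n < m`, the incoming point `n` of `φ` would end at an outgoing point of index `n`, which
    -- `φ` does not have.
    have hle : m ≤ n := by
      by_contra! hlt
      obtain ⟨j, -, hj⟩ := h1 ⟨n, hlt⟩
      exact absurd j.2 (by simp [hj])
    -- If `m < n`, then `r > 0`, and the first incoming point of `ψ`, at height `m`, would end at
    -- height at least `n`.
    have hge : n ≤ m := by
      by_contra! hlt
      obtain ⟨j, -, hj⟩ := h2 ⟨0, by omega⟩
      simp at hj
      omega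
    refine ⟨⟨by omega, by omega, h1⟩, ⟨by omega, by omega, fun i => ?_⟩⟩
    obtain ⟨j, hj, e⟩ := h2 i
    exact ⟨j, hj, by omega⟩
  · rintro ⟨⟨hl, rfl, h1⟩, ⟨hl', rfl, h2⟩⟩
    refine ⟨by rw [BrauerHom.tensor, hl, hl'], rfl, fun i => Fin.addCases (fun i => ?_) (fun i => ?_) i⟩
    · obtain ⟨j, hj, e⟩ := h1 i
      exact ⟨Fin.castAdd _ j, by rw [e1, hj]; rfl, e⟩
    · obtain ⟨j, hj, e⟩ := h2 i
      exact ⟨Fin.natAdd _ j, by rw [e2, hj]; rfl, by simp [e]⟩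

end BrauerMor

/-! ### Restriction of manifolds to open sets -/

section Local

variable {E H : Type*} [NormedAddCommGroup E] [NormedSpace ℝ E]
  [NormedAddCommGroup H] [NormedSpace ℝ H] {X U : Set E} {x : E}

theorem tanSpace_inter (hU : IsOpen U) (hx : x ∈ U) : tanSpace (X ∩ U) x = tanSpace X x := by
  unfold tanSpace
  rw [tangentConeAt_inter_nhds (hU.mem_nhds hx)]

theorem SmoothOn.mono {f : E → ℂ} {Y : Set E} (h : SmoothOn f X) (hY : Y ⊆ X) : SmoothOn f Y := by
  intro x hx
  obtain ⟨T, g, hT, hxT, hg, hfg⟩ := h x (hY hx)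
  exact ⟨T, g, hT, hxT, hg, hfg.mono (Set.inter_subset_inter_left _ hY)⟩

theorem SmoothOn.of_inter {f : E → ℂ} (hU : IsOpen U) (h : SmoothOn f (X ∩ U)) :
    ∀ x ∈ X ∩ U, ∃ (T : Set E) (g : E → ℂ), IsOpen T ∧ x ∈ T ∧ ContDiffOn ℝ ∞ g T ∧
      Set.EqOn f g (X ∩ T) := by
  intro x hx
  obtain ⟨T, g, hT, hxT, hg, hfg⟩ := h x hx
  exact ⟨T ∩ U, g, hT.inter hU, ⟨hxT, hx.2⟩, hg.mono Set.inter_subset_left,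
    fun y hy => hfg ⟨⟨hy.1, hy.2.2⟩, hy.2.1⟩⟩

theorem SmoothOn.congr {f g : E → ℂ} (h : SmoothOn f X) (hfg : Set.EqOn f g X) :
    SmoothOn g X := by
  intro x hx
  obtain ⟨T, k, hT, hxT, hk, hfk⟩ := h x hx
  exact ⟨T, k, hT, hxT, hk, fun y hy => (hfg hy.1).symm.trans (hfk hy)⟩

theorem IsParam.of_inter {O : Set H} {φ : H → E} (hU : IsOpen U) (h : IsParam (X ∩ U) O φ) :
    IsParam X O φ where
  smooth := h.smooth
  immersion := h.immersion
  embedding := h.embedding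
  image := by
    obtain ⟨T, hT, e⟩ := h.image
    exact ⟨U ∩ T, hU.inter hT, by rw [e, Set.inter_assoc]⟩

/-- `φ` is continuous only on `O`, so `φ ⁻¹' U` need not be open; an open `V` with the same trace on
`O` replaces it. -/
theorem IsParam.inter {O V : Set H} {φ : H → E} (h : IsParam X O φ) (hV : IsOpen V)
    (hOV : φ ⁻¹' U ∩ O = V ∩ O) : IsParam (X ∩ U) (O ∩ V) φ where
  smooth := h.smooth.mono Set.inter_subset_left
  immersion := fun u hu => by
    rw [fderivWithin_inter (hV.mem_nhds hu.2)]
    exact h.immersion u hu.1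
  embedding := h.embedding.comp (Topology.IsEmbedding.inclusion Set.inter_subset_left)
  image := by
    obtain ⟨T, hT, e⟩ := h.image
    refine ⟨T, hT, ?_⟩
    rw [Set.inter_comm O V, ← hOV, Set.inter_comm, Set.image_inter_preimage, e,
      Set.inter_right_comm]

theorem IsParam.exists_preimage {O : Set H} {φ : H → E} (h : IsParam X O φ) (hU : IsOpen U) :
    ∃ V : Set H, IsOpen V ∧ φ ⁻¹' U ∩ O = V ∩ O :=
  continuousOn_iff'.1 h.smooth.continuousOn U hU

end Local

variable {n D : ℕ}

theorem IsOpenHalf.inter {O V : Set (Model n)} (h : IsOpenHalf n O) (hV : IsOpen V) :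
    IsOpenHalf n (O ∩ V) := by
  obtain ⟨T, hT, rfl⟩ := h
  exact ⟨T ∩ V, hT.inter hV, Set.inter_right_comm _ _ _⟩

theorem bdry_inter {X U : Set (Spacetime D)} (hU : IsOpen U) :
    bdry n (X ∩ U) = bdry n X ∩ U := by
  ext x
  constructor
  · rintro ⟨O, φ, hO, hφ, u, hu, hu0, rfl⟩
    obtain ⟨T, hT, e⟩ := hφ.image
    have : φ u ∈ X ∩ U ∩ T := e ▸ Set.mem_image_of_mem φ hu
    exact ⟨⟨O, φ, hO, hφ.of_inter hU, u, hu, hu0, rfl⟩, this.1.2⟩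
  · rintro ⟨⟨O, φ, hO, hφ, u, hu, hu0, rfl⟩, hx⟩
    obtain ⟨V, hV, e⟩ := hφ.exists_preimage hU
    have : u ∈ V ∩ O := e ▸ ⟨hx, hu⟩
    exact ⟨O ∩ V, φ, hO.inter hV, hφ.inter hV e, u, this.symm, hu0, rfl⟩

/-! ### Fold maps: restriction to open sets and gluing. -/

section FoldMaps

variable {f g : Spacetime D → ℂ} {X U : Set (Spacetime D)}

theorem rankAt_inter (hU : IsOpen U) {x : Spacetime D} (hx : x ∈ U) :
    rankAt f (X ∩ U) x = rankAt f X x := by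
  unfold rankAt
  rw [tanSpace_inter hU hx, fderivWithin_inter (hU.mem_nhds hx)]

theorem singularSet_inter (hU : IsOpen U) : singularSet f (X ∩ U) = singularSet f X ∩ U := by
  ext x
  constructor
  · rintro ⟨⟨hx, hxU⟩, h⟩
    exact ⟨⟨hx, by rwa [rankAt_inter hU hxU] at h⟩, hxU⟩
  · rintro ⟨⟨hx, h⟩, hxU⟩
    exact ⟨⟨hx, hxU⟩, by rwa [rankAt_inter hU hxU]⟩

theorem jet_inter {k : Model n → ℂ} {O V : Set (Model n)} (hV : IsOpen V) {u : Model n}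
    (hu : u ∈ V) : jet k (O ∩ V) u = jet k O u := by
  unfold jet
  rw [fderivWithin_inter (hV.mem_nhds hu)]

/-- The jet itself depends on the domain, so both the outer derivative and the function being
differentiated change; the two jets agree near `u`. -/
theorem fderivWithin_jet_inter {k : Model n → ℂ} {O V : Set (Model n)} (hV : IsOpen V)
    {u : Model n} (hu : u ∈ V) :
    fderivWithin ℝ (jet k (O ∩ V)) (O ∩ V) u = fderivWithin ℝ (jet k O) O u := by
  rw [fderivWithin_inter (hV.mem_nhds hu)]
  refine Filter.EventuallyEq.fderivWithin_eq ?_ (jet_inter hV hu)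
  filter_upwards [mem_nhdsWithin_of_mem_nhds (hV.mem_nhds hu)] with w hw
  exact jet_inter hV hw

theorem IsFoldMap.inter (h : IsFoldMap n f X) (hU : IsOpen U) : IsFoldMap n f (X ∩ U) where
  smooth := h.smooth.mono Set.inter_subset_left
  transverse := fun O φ hO hφ => h.transverse O φ hO (hφ.of_inter hU)
  corank_one := fun x hx => by
    rw [singularSet_inter hU] at hx
    rw [rankAt_inter hU hx.2]
    exact h.corank_one x hx.1
  no_cusp := fun x hx => by
    rw [singularSet_inter hU] at hx
    rw [singularSet_inter hU, tanSpace_inter hU hx.2, tanSpace_inter hU hx.2,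
      fderivWithin_inter (hU.mem_nhds hx.2)]
    exact h.no_cusp x hx.1

/-- All conditions are pointwise and local. A chart that meets both open sets is cut down near the
point at which transversality is tested. -/
theorem IsFoldMap.of_inter {U' : Set (Spacetime D)} (hU : IsOpen U) (hU' : IsOpen U')
    (hX : X ⊆ U ∪ U') (h : IsFoldMap n f (X ∩ U)) (h' : IsFoldMap n f (X ∩ U')) :
    IsFoldMap n f X where
  smooth := fun x hx => (hX hx).elim (fun hxU => h.smooth.of_inter hU x ⟨hx, hxU⟩)
    fun hxU => h'.smooth.of_inter hU' x ⟨hx, hxU⟩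
  transverse := by
    intro O φ hO hφ u hu
    have key : ∀ T : Set (Spacetime D), IsOpen T → φ u ∈ T → IsFoldMap n f (X ∩ T) →
        jet (f ∘ φ) O u ∈ jetStratum n →
        LinearMap.range (fderivWithin ℝ (jet (f ∘ φ) O) O u).toLinearMap ⊔
          tanSpace (jetStratum n) (jet (f ∘ φ) O u) = ⊤ := by
      intro T hT huT hf
      obtain ⟨V, hV, e⟩ := hφ.exists_preimage hT
      have huV : u ∈ V ∩ O := e ▸ ⟨huT, hu⟩
      have := hf.transverse (O ∩ V) φ (hO.inter hV) (hφ.inter hV e) u huV.symm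
      rwa [jet_inter hV huV.1, fderivWithin_jet_inter hV huV.1] at this
    obtain ⟨T, hT, e⟩ := hφ.image
    have hxX : φ u ∈ X ∩ T := e ▸ Set.mem_image_of_mem φ hu
    exact (hX hxX.1).elim (fun hxU => key U hU hxU h) fun hxU => key U' hU' hxU h'
  corank_one := by
    intro x hx
    rcases hX hx.1 with hxU | hxU
    · rw [← rankAt_inter hU hxU]
      exact h.corank_one x (by rw [singularSet_inter hU]; exact ⟨hx, hxU⟩)
    · rw [← rankAt_inter hU' hxU]
      exact h'.corank_one x (by rw [singularSet_inter hU']; exact ⟨hx, hxU⟩)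
  no_cusp := by
    intro x hx
    rcases hX hx.1 with hxU | hxU
    · have := h.no_cusp x (by rw [singularSet_inter hU]; exact ⟨hx, hxU⟩)
      rwa [singularSet_inter hU, tanSpace_inter hU hxU, tanSpace_inter hU hxU,
        fderivWithin_inter (hU.mem_nhds hxU)] at this
    · have := h'.no_cusp x (by rw [singularSet_inter hU']; exact ⟨hx, hxU⟩)
      rwa [singularSet_inter hU', tanSpace_inter hU' hxU, tanSpace_inter hU' hxU,
        fderivWithin_inter (hU'.mem_nhds hxU)] at this

/-! ### Dependence on the values of a field on its domain -/

theorem rankAt_congr (hfg : Set.EqOn f g X) {x : Spacetime D} (hx : x ∈ X) :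
    rankAt f X x = rankAt g X x := by
  unfold rankAt
  rw [fderivWithin_congr hfg (hfg hx)]

theorem singularSet_congr (hfg : Set.EqOn f g X) : singularSet f X = singularSet g X := by
  ext x
  exact and_congr_right fun hx => by rw [rankAt_congr hfg hx]

theorem IsFoldMap.congr (h : IsFoldMap n f X) (hfg : Set.EqOn f g X) : IsFoldMap n g X where
  smooth := h.smooth.congr hfg
  transverse := by
    intro O φ hO hφ u hu
    obtain ⟨T, hT, e⟩ := hφ.image
    have hcomp : Set.EqOn (g ∘ φ) (f ∘ φ) O := fun w hw => by
      have : φ w ∈ X ∩ T := e ▸ Set.mem_image_of_mem φ hw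
      exact (hfg this.1).symm
    have hjet : Set.EqOn (jet (g ∘ φ) O) (jet (f ∘ φ) O) O := fun w hw => by
      simp only [jet, fderivWithin_congr hcomp (hcomp hw), hcomp hw]
    rw [hjet hu, fderivWithin_congr hjet (hjet hu)]
    exact h.transverse O φ hO hφ u hu
  corank_one := fun x hx => by
    rw [← singularSet_congr hfg] at hx
    rw [← rankAt_congr hfg hx.1]
    exact h.corank_one x hx
  no_cusp := fun x hx => by
    rw [← singularSet_congr hfg] at hx
    rw [← singularSet_congr hfg, ← fderivWithin_congr hfg (hfg hx.1)]
    exact h.no_cusp x hx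

theorem transverseTimes_congr (hfg : Set.EqOn f g X) :
    transverseTimes f X = transverseTimes g X := by
  unfold transverseTimes
  rw [singularSet_congr hfg]

theorem genIm_congr (hfg : Set.EqOn f g X) : genIm f X = genIm g X := by
  unfold genIm
  rw [singularSet_congr hfg]
  ext t
  refine and_congr_right fun _ => Set.EqOn.injOn_iff fun x hx => ?_
  exact congrArg Complex.im (hfg hx.1.1)

theorem slice_subset (k : ℕ) : slice X k ⊆ X := fun _ hx => hx.1

theorem IsFoldField.congr (h : IsFoldField n f X) (hfg : Set.EqOn f g X) :
    IsFoldField n g X where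
  fold := h.fold.congr hfg
  ends := fun k hk t ht => by
    rw [← transverseTimes_congr (hfg.mono (slice_subset k)),
      ← genIm_congr (hfg.mono (slice_subset k))]
    exact h.ends k hk t ht
  generic := fun k hk => by
    rw [← genIm_congr (hfg.mono (slice_subset k))]
    exact h.generic k hk

theorem IsBrauerOf.congr {φ : BrauerMor} (h : IsBrauerOf f X φ) (hfg : Set.EqOn f g X) :
    IsBrauerOf g X φ := by
  obtain ⟨p, q, hp, hq, hpm, hqm, hs, hl⟩ := h
  have ep : ∀ i, f (p i) = g (p i) := fun i => by
    have : p i ∈ timeSlice (singularSet f X) 0 := hp ▸ Set.mem_range_self i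
    exact hfg this.1.1
  have eq : ∀ i, f (q i) = g (q i) := fun i => by
    have : q i ∈ timeSlice (singularSet f X) 1 := hq ▸ Set.mem_range_self i
    exact hfg this.1.1
  rw [singularSet_congr hfg] at hp hq hs hl
  exact ⟨p, q, hp, hq, by simpa only [ep] using hpm, by simpa only [eq] using hqm, hs, hl⟩

theorem sliceAction_congr (hfg : Set.EqOn f g X) : sliceAction f X = sliceAction g X := by
  classical
  -- `sliceAction` is defined by choice, so the predicates must be equal for the chosen morphisms to
  -- agree.
  have key : ∀ P Q : BrauerMor → Prop, P = Q →
      (if h : X.Nonempty ∧ ∃ φ, P φ then h.2.choose else BrauerMor.identity 0) =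
        if h : X.Nonempty ∧ ∃ φ, Q φ then h.2.choose else BrauerMor.identity 0 := by
    rintro P _ rfl
    rfl
  unfold sliceAction
  convert key (IsBrauerOf f X) (IsBrauerOf g X)
    (funext fun φ => propext ⟨fun h => h.congr hfg, fun h => h.congr hfg.symm⟩)

end FoldMaps

/-! ### Disjoint unions of fold fields -/

section Union

variable {f : Spacetime D → ℂ} {A B C : Set (Spacetime D)}

theorem slice_union (k : ℕ) : slice (A ∪ B) k = slice A k ∪ slice B k := by
  ext x
  simp only [slice, Set.mem_union, Set.mem_ofPred_eq, or_and_right]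

theorem slice_eq_self {j : ℕ} (hA : ∀ x ∈ A, x.2.1 = j) : slice A j = A :=
  Set.ext fun x => ⟨fun h => h.1, fun h => ⟨h, hA x h⟩⟩

theorem slice_eq_empty {j k : ℕ} (hA : ∀ x ∈ A, x.2.1 = j) (hk : k ≠ j) : slice A k = ∅ := by
  refine Set.eq_empty_of_forall_notMem fun x hx => hk ?_
  exact_mod_cast hx.2.symm.trans (hA x hx.1)

/-- The open set of all points of spacetime near the slice `0`. -/
def lowerPart (D : ℕ) : Set (Spacetime D) := {x | x.2.1 < 1 / 2}

/-- The open set of all points of spacetime near the slice `1`. -/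
def upperPart (D : ℕ) : Set (Spacetime D) := {x | 1 / 2 < x.2.1}

theorem isOpen_lowerPart : IsOpen (lowerPart D) := isOpen_lt (by fun_prop) (by fun_prop)

theorem isOpen_upperPart : IsOpen (upperPart D) := isOpen_lt (by fun_prop) (by fun_prop)

theorem union_inter_lowerPart (hA : ∀ x ∈ A, x.2.1 = 0) (hB : ∀ x ∈ B, x.2.1 = 1) :
    (A ∪ B) ∩ lowerPart D = A := by
  ext x
  constructor
  · rintro ⟨hx | hx, h⟩
    · exact hx
    · have : x.2.1 < 1 / 2 := h
      rw [hB x hx] at this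
      norm_num at this
  · exact fun hx => ⟨.inl hx, show x.2.1 < 1 / 2 by rw [hA x hx]; norm_num⟩

theorem union_inter_upperPart (hA : ∀ x ∈ A, x.2.1 = 0) (hB : ∀ x ∈ B, x.2.1 = 1) :
    (A ∪ B) ∩ upperPart D = B := by
  ext x
  constructor
  · rintro ⟨hx | hx, h⟩
    · have : 1 / 2 < x.2.1 := h
      rw [hA x hx] at this
      norm_num at this
    · exact hx
  · exact fun hx => ⟨.inr hx, show 1 / 2 < x.2.1 by rw [hB x hx]; norm_num⟩

theorem union_subset_parts (hA : ∀ x ∈ A, x.2.1 = 0) (hB : ∀ x ∈ B, x.2.1 = 1) :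
    A ∪ B ⊆ lowerPart D ∪ upperPart D := by
  rintro x (hx | hx)
  · exact .inl (show x.2.1 < 1 / 2 by rw [hA x hx]; norm_num)
  · exact .inr (show 1 / 2 < x.2.1 by rw [hB x hx]; norm_num)

theorem isFoldMap_union (hA : ∀ x ∈ A, x.2.1 = 0) (hB : ∀ x ∈ B, x.2.1 = 1) :
    IsFoldMap n f (A ∪ B) ↔ IsFoldMap n f A ∧ IsFoldMap n f B := by
  have e := union_inter_lowerPart hA hB
  have e' := union_inter_upperPart hA hB
  constructor
  · intro h
    have h1 := h.inter isOpen_lowerPart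
    have h2 := h.inter isOpen_upperPart
    rw [e] at h1
    rw [e'] at h2
    exact ⟨h1, h2⟩
  · rintro ⟨h1, h2⟩
    rw [← e] at h1
    rw [← e'] at h2
    exact IsFoldMap.of_inter isOpen_lowerPart isOpen_upperPart (union_subset_parts hA hB) h1 h2

/-- At most one of the two pieces meets slice `k`; `P ∅` covers the piece that is missing there. -/
theorem forall_slice_union (hA : ∀ x ∈ A, x.2.1 = 0) (hB : ∀ x ∈ B, x.2.1 = 1)
    (P : Set (Spacetime D) → Prop) (hP : P ∅) :
    (∀ k, P (slice (A ∪ B) k)) ↔ (∀ k, P (slice A k)) ∧ ∀ k, P (slice B k) := by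
  rw [← forall_and]
  refine forall_congr' fun k => ?_
  rw [slice_union]
  by_cases hk : k = 0
  · rw [slice_eq_empty (A := B) (j := 1) (by exact_mod_cast hB) (by omega : k ≠ 1), Set.union_empty]
    exact ⟨fun h => ⟨h, hP⟩, fun h => h.1⟩
  · rw [slice_eq_empty (A := A) (j := 0) (by exact_mod_cast hA) hk, Set.empty_union]
    exact ⟨fun h => ⟨hP, h⟩, fun h => h.2⟩

theorem isFoldField_union (hA : ∀ x ∈ A, x.2.1 = 0) (hB : ∀ x ∈ B, x.2.1 = 1) :
    IsFoldField n f (A ∪ B) ↔ IsFoldField n f A ∧ IsFoldField n f B := by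
  have h1 := isFoldMap_union (n := n) (f := f) hA hB
  have h2 := forall_slice_union hA hB (fun X => X.Nonempty → ∀ t ∈ ({0, 1} : Set ℝ),
    t ∈ transverseTimes f X ∩ genIm f X) (fun h => absurd h Set.not_nonempty_empty)
  have h3 := forall_slice_union hA hB (fun X => X.Nonempty →
    {t : Set.Icc (0 : ℝ) 1 | (t : ℝ) ∈ genIm f X} ∈ residual (Set.Icc (0 : ℝ) 1))
    (fun h => absurd h Set.not_nonempty_empty)
  constructor
  · rintro ⟨a, b, c⟩
    exact ⟨⟨(h1.1 a).1, (h2.1 b).1, (h3.1 c).1⟩, ⟨(h1.1 a).2, (h2.1 b).2, (h3.1 c).2⟩⟩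
  · rintro ⟨⟨a, b, c⟩, ⟨a', b', c'⟩⟩
    exact ⟨h1.2 ⟨a, a'⟩, h2.2 ⟨b, b'⟩, h3.2 ⟨c, c'⟩⟩

/-! ### Gluing and restricting fold fields. -/

theorem extendZero_eqOn (f : Spacetime D → ℂ) (A : Set (Spacetime D)) :
    Set.EqOn (extendZero fun x : A => f x) f A := fun x hx => by
  simp [extendZero, hx]

namespace FoldField

/-- The fold field given by a function on spacetime. -/
def ofFn (f : Spacetime D → ℂ) (h : IsFoldField n f A) : FoldField n A :=
  ⟨fun x => f x, h.congr (extendZero_eqOn f A).symm⟩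

theorem ofFn_eqOn (h : IsFoldField n f A) : Set.EqOn (ofFn f h).fn f A := extendZero_eqOn f A

theorem isFoldField (F : FoldField n A) : IsFoldField n F.fn A := F.2

theorem ext_fn {F G : FoldField n A} (h : Set.EqOn F.fn G.fn A) : F = G := by
  refine Subtype.ext (funext fun x => ?_)
  have := h x.2
  simpa [fn, extendZero] using this

open scoped Classical in
/-- Disjoint union of fold fields as a bijection. -/
def unionEquiv (hA : ∀ x ∈ A, x.2.1 = 0) (hB : ∀ x ∈ B, x.2.1 = 1) (hC : C = A ∪ B) :
    FoldField n A × FoldField n B ≃ FoldField n C where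
  toFun p := ofFn (A.piecewise p.1.fn p.2.fn) <| by
    rw [hC, isFoldField_union hA hB]
    refine ⟨p.1.isFoldField.congr (Set.piecewise_eqOn _ _ _).symm,
      p.2.isFoldField.congr fun x hx => (Set.piecewise_eq_of_notMem _ _ _ fun h => ?_).symm⟩
    have := (hA x h).symm.trans (hB x hx)
    norm_num at this
  invFun F := (ofFn F.fn (((isFoldField_union hA hB).1 (hC ▸ F.isFoldField)).1),
    ofFn F.fn (((isFoldField_union hA hB).1 (hC ▸ F.isFoldField)).2))
  left_inv p := by
    refine Prod.ext (ext_fn ?_) (ext_fn ?_)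
    · intro x hx
      rw [ofFn_eqOn _ hx, ofFn_eqOn _ (hC ▸ .inl hx), Set.piecewise_eq_of_mem _ _ _ hx]
    · intro x hx
      rw [ofFn_eqOn _ hx, ofFn_eqOn _ (hC ▸ .inr hx), Set.piecewise_eq_of_notMem]
      intro h
      have := (hA x h).symm.trans (hB x hx)
      norm_num at this
  right_inv F := by
    refine ext_fn fun x hx => ?_
    rw [ofFn_eqOn _ hx]
    by_cases h : x ∈ A
    · rw [Set.piecewise_eq_of_mem _ _ _ h, ofFn_eqOn _ h]
    · rw [Set.piecewise_eq_of_notMem _ _ _ h, ofFn_eqOn _]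
      rw [hC] at hx
      exact hx.resolve_left h

theorem unionEquiv_eqOn (hA : ∀ x ∈ A, x.2.1 = 0) (hB : ∀ x ∈ B, x.2.1 = 1) (hC : C = A ∪ B)
    (p : FoldField n A × FoldField n B) :
    Set.EqOn (unionEquiv hA hB hC p).fn p.1.fn A ∧ Set.EqOn (unionEquiv hA hB hC p).fn p.2.fn B := by
  subst hC
  -- Writing `p` as the pair of restrictions of a field `F` makes both agreements immediate.
  obtain ⟨F, rfl⟩ := (unionEquiv hA hB rfl).symm.surjective p
  rw [Equiv.apply_symm_apply]
  have h := (isFoldField_union hA hB).1 F.isFoldField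
  exact ⟨(ofFn_eqOn h.1).symm, (ofFn_eqOn h.2).symm⟩

end FoldField

/-! ### The action functional under disjoint union. -/

theorem sliceAction_empty : sliceAction f ∅ = BrauerMor.identity 0 := by
  unfold sliceAction
  rw [dif_neg]
  exact fun h => Set.not_nonempty_empty h.1

/-- Empty slices contribute the unit `1_[0]`, so the product may stop at any bound instead of the
least one. -/
theorem action_eq_actionBelow (F : FoldField n A) {K : ℕ} (hK : ∀ k ≥ K, slice A k = ∅) :
    action F = actionBelow F.fn A K := by
  unfold action
  have hmem : sInf {K : ℕ | ∀ k ≥ K, slice A k = ∅} ∈ {K : ℕ | ∀ k ≥ K, slice A k = ∅} :=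
    Nat.sInf_mem ⟨K, hK⟩
  have hle : sInf {K : ℕ | ∀ k ≥ K, slice A k = ∅} ≤ K := Nat.sInf_le hK
  induction K, hle using Nat.le_induction with
  | base => rfl
  | succ k hk ih =>
    rw [actionBelow, hmem k hk, sliceAction_empty, BrauerMor.tensor_identity_zero]
    exact ih fun j hj => hmem j (hk.trans hj)

theorem action_of_slice_zero (hA : ∀ x ∈ A, x.2.1 = 0) (F : FoldField n A) :
    action F = sliceAction F.fn A := by
  have hA' : ∀ x ∈ A, x.2.1 = (0 : ℕ) := by exact_mod_cast hA
  rw [action_eq_actionBelow F (K := 1) fun k hk => slice_eq_empty hA' (by omega)]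
  simp only [actionBelow]
  rw [slice_eq_self hA', BrauerMor.identity_zero_tensor]

theorem action_of_slice_one (hB : ∀ x ∈ B, x.2.1 = 1) (F : FoldField n B) :
    action F = sliceAction F.fn B := by
  have hB' : ∀ x ∈ B, x.2.1 = (1 : ℕ) := by exact_mod_cast hB
  rw [action_eq_actionBelow F (K := 2) fun k hk => slice_eq_empty hB' (by omega)]
  simp only [actionBelow]
  rw [slice_eq_self hB', slice_eq_empty hB' (by omega : 0 ≠ 1), sliceAction_empty,
    BrauerMor.identity_zero_tensor, BrauerMor.identity_zero_tensor]

/-- The action functional is multiplicative under disjoint union. -/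
theorem action_unionEquiv (hA : ∀ x ∈ A, x.2.1 = 0) (hB : ∀ x ∈ B, x.2.1 = 1) (hC : C = A ∪ B)
    (p : FoldField n A × FoldField n B) :
    action (FoldField.unionEquiv hA hB hC p) = (action p.1).tensor (action p.2) := by
  have hA' : ∀ x ∈ A, x.2.1 = (0 : ℕ) := by exact_mod_cast hA
  have hB' : ∀ x ∈ B, x.2.1 = (1 : ℕ) := by exact_mod_cast hB
  obtain ⟨h1, h2⟩ := FoldField.unionEquiv_eqOn hA hB hC p
  rw [action_of_slice_zero hA, action_of_slice_one hB, ← sliceAction_congr h1,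
    ← sliceAction_congr h2, action_eq_actionBelow _ (K := 2)]
  · simp only [actionBelow]
    have e0 : slice C 0 = A := by
      rw [hC, slice_union, slice_eq_self hA', slice_eq_empty hB' (by omega : 0 ≠ 1),
        Set.union_empty]
    have e1 : slice C 1 = B := by
      rw [hC, slice_union, slice_eq_self hB', slice_eq_empty hA' (by omega : 1 ≠ 0),
        Set.empty_union]
    rw [e0, e1, BrauerMor.identity_zero_tensor]
  · intro k hk
    rw [hC, slice_union, slice_eq_empty hA' (by omega), slice_eq_empty hB' (by omega),
      Set.union_empty]

end Union

variable {n D : ℕ}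

/-! ### Disjoint unions of cobordisms -/

theorem connectedComponentIn_union_subset {E : Type*} [TopologicalSpace E] {h : E → ℝ}
    (hh : Continuous h) {A B : Set E} (hA : ∀ x ∈ A, h x = 0) (hB : ∀ x ∈ B, h x = 1) {x : E}
    (hx : x ∈ A ∪ B) : ∃ k : ℕ, connectedComponentIn (A ∪ B) x ⊆ {y | h y = k} := by
  have h01 : ∀ y ∈ A ∪ B, h y ∈ ({0, 1} : Set ℝ) := by
    rintro y (hy | hy)
    · exact .inl (hA y hy)
    · exact .inr (hB y hy)
  have hc : (h '' connectedComponentIn (A ∪ B) x).Subsingleton := by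
    refine Set.not_nontrivial_iff.1 fun hnt => ?_
    -- A preconnected subset of `ℝ` with two points is infinite, but `h` takes only the values `0`
    -- and `1`.
    refine (isPreconnected_connectedComponentIn.image h hh.continuousOn).infinite_of_nontrivial hnt
      ((Set.toFinite {0, 1}).subset ?_)
    rintro _ ⟨y, hy, rfl⟩
    exact h01 y (connectedComponentIn_subset _ _ hy)
  have key : ∀ y ∈ connectedComponentIn (A ∪ B) x, h y = h x := fun y hy =>
    hc (Set.mem_image_of_mem h hy) (Set.mem_image_of_mem h (mem_connectedComponentIn hx))
  rcases hx with hx | hx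
  · exact ⟨0, fun y hy => by simp [key y hy, hA x hx]⟩
  · exact ⟨1, fun y hy => by simp [key y hy, hB x hx]⟩

theorem IsClosedManifold.union {M M' : Set (Space D)} (h : IsClosedManifold n M)
    (h' : IsClosedManifold n M') (hM : ∀ x ∈ M, x.1 = 0) (hM' : ∀ x ∈ M', x.1 = 1) :
    IsClosedManifold n (M ∪ M') where
  compact := h.compact.union h'.compact
  chart := by
    have e : (M ∪ M') ∩ {x : Space D | x.1 < 1 / 2} = M := by
      ext x
      constructor
      · rintro ⟨hx | hx, hlt⟩
        · exact hx
        · have : x.1 < 1 / 2 := hlt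
          rw [hM' x hx] at this
          norm_num at this
      · exact fun hx => ⟨.inl hx, show x.1 < 1 / 2 by rw [hM x hx]; norm_num⟩
    have e' : (M ∪ M') ∩ {x : Space D | 1 / 2 < x.1} = M' := by
      ext x
      constructor
      · rintro ⟨hx | hx, hlt⟩
        · have : 1 / 2 < x.1 := hlt
          rw [hM x hx] at this
          norm_num at this
        · exact hx
      · exact fun hx => ⟨.inr hx, show 1 / 2 < x.1 by rw [hM' x hx]; norm_num⟩
    rintro x (hx | hx)
    · obtain ⟨O, φ, hO, hφ, hxφ⟩ := h.chart x hx
      refine ⟨O, φ, hO, IsParam.of_inter (U := {x : Space D | x.1 < 1 / 2})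
        (isOpen_lt (by fun_prop) (by fun_prop)) (by rwa [e]), hxφ⟩
    · obtain ⟨O, φ, hO, hφ, hxφ⟩ := h'.chart x hx
      refine ⟨O, φ, hO, IsParam.of_inter (U := {x : Space D | 1 / 2 < x.1})
        (isOpen_lt (by fun_prop) (by fun_prop)) (by rwa [e']), hxφ⟩
  slices := fun _ hx => connectedComponentIn_union_subset continuous_fst hM hM' hx

theorem IsCylinderScale.union {M N M' N' : Set (Space D)} {W W' : Set (Spacetime D)} {ε : ℝ}
    (h : IsCylinderScale M N W ε) (h' : IsCylinderScale M' N' W' ε) :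
    IsCylinderScale (M ∪ M') (N ∪ N') (W ∪ W') ε where
  pos := h.pos
  lt_half := h.lt_half
  incoming := by rw [Set.union_inter_distrib_right, h.incoming, h'.incoming, Set.prod_union]
  outgoing := by rw [Set.union_inter_distrib_right, h.outgoing, h'.outgoing, Set.prod_union]

/-- Boundary points are detected by charts, hence locally: each part of the union is cut out by an
open set, and `bdry_inter` applies. -/
theorem bdry_union {W W' : Set (Spacetime D)} (hW : ∀ x ∈ W, x.2.1 = 0)
    (hW' : ∀ x ∈ W', x.2.1 = 1) : bdry n (W ∪ W') = bdry n W ∪ bdry n W' := by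
  have hsub : bdry n (W ∪ W') ⊆ W ∪ W' := by
    rintro _ ⟨O, φ, hO, hφ, u, hu, -, rfl⟩
    obtain ⟨T, hT, e⟩ := hφ.image
    have : φ u ∈ (W ∪ W') ∩ T := e ▸ Set.mem_image_of_mem φ hu
    exact this.1
  have e1 := bdry_inter (n := n) (X := W ∪ W') (isOpen_lowerPart (D := D))
  have e2 := bdry_inter (n := n) (X := W ∪ W') (isOpen_upperPart (D := D))
  rw [union_inter_lowerPart hW hW'] at e1
  rw [union_inter_upperPart hW hW'] at e2
  rw [e1, e2, ← Set.inter_union_distrib_left]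
  exact (Set.inter_eq_left.2 (hsub.trans (union_subset_parts hW hW'))).symm

theorem IsCylinderScale.incoming_mem {M N : Set (Space D)} {W : Set (Spacetime D)} {ε : ℝ}
    (h : IsCylinderScale M N W ε) {t : ℝ} (ht : t ∈ Set.Icc 0 ε) {x : Space D} (hx : x ∈ M) :
    (t, x) ∈ W := by
  have : (t, x) ∈ Set.Icc 0 ε ×ˢ M := ⟨ht, hx⟩
  rw [← h.incoming] at this
  exact this.1

theorem IsCylinderScale.outgoing_mem {M N : Set (Space D)} {W : Set (Spacetime D)} {ε : ℝ}
    (h : IsCylinderScale M N W ε) {t : ℝ} (ht : t ∈ Set.Icc (1 - ε) 1) {x : Space D}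
    (hx : x ∈ N) : (t, x) ∈ W := by
  have : (t, x) ∈ Set.Icc (1 - ε) 1 ×ˢ N := ⟨ht, hx⟩
  rw [← h.outgoing] at this
  exact this.1

/-- The collar contains `{0} × M`, so the end lies in the slice of the cobordism. -/
theorem IsCylinderScale.slice_in {M N : Set (Space D)} {W : Set (Spacetime D)} {ε c : ℝ}
    (h : IsCylinderScale M N W ε) (hW : ∀ x ∈ W, x.2.1 = c) : ∀ x ∈ M, x.1 = c :=
  fun _ hx => hW _ (h.incoming_mem ⟨le_rfl, h.pos.le⟩ hx)

theorem IsCylinderScale.slice_out {M N : Set (Space D)} {W : Set (Spacetime D)} {ε c : ℝ}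
    (h : IsCylinderScale M N W ε) (hW : ∀ x ∈ W, x.2.1 = c) : ∀ x ∈ N, x.1 = c :=
  fun _ hx => hW _ (h.outgoing_mem ⟨by linarith [h.pos], le_rfl⟩ hx)

theorem IsCobordism.union {M N M' N' : Set (Space D)} {W W' : Set (Spacetime D)} {ε : ℝ}
    (h : IsCobordism n M N W) (h' : IsCobordism n M' N' W') (hW : ∀ x ∈ W, x.2.1 = 0)
    (hW' : ∀ x ∈ W', x.2.1 = 1) (hε : IsCylinderScale M N W ε)
    (hε' : IsCylinderScale M' N' W' ε) : IsCobordism n (M ∪ M') (N ∪ N') (W ∪ W') where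
  closed_in := h.closed_in.union h'.closed_in (hε.slice_in hW) (hε'.slice_in hW')
  closed_out := h.closed_out.union h'.closed_out (hε.slice_out hW) (hε'.slice_out hW')
  compact := h.compact.union h'.compact
  chart := by
    rintro x (hx | hx)
    · obtain ⟨O, φ, hO, hφ, hxφ⟩ := h.chart x hx
      exact ⟨O, φ, hO, IsParam.of_inter isOpen_lowerPart
        (by rwa [union_inter_lowerPart hW hW']), hxφ⟩
    · obtain ⟨O, φ, hO, hφ, hxφ⟩ := h'.chart x hx
      exact ⟨O, φ, hO, IsParam.of_inter isOpen_upperPart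
        (by rwa [union_inter_upperPart hW hW']), hxφ⟩
  subset := Set.union_subset h.subset h'.subset
  bdry_eq := by
    rw [bdry_union hW hW', h.bdry_eq, h'.bdry_eq, Set.prod_union, Set.prod_union,
      Set.union_union_union_comm]
  interior_subset := by
    rw [bdry_union hW hW']
    rintro x ⟨hx | hx, hb⟩
    · exact h.interior_subset ⟨hx, fun hx' => hb (.inl hx')⟩
    · exact h'.interior_subset ⟨hx, fun hx' => hb (.inr hx')⟩
  cylinder := ⟨ε, hε.union hε'⟩
  slices := fun _ hx => connectedComponentIn_union_subset
    (continuous_fst.comp continuous_snd) hW hW' hx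

/-! ### Boundary conditions and disjoint unions -/

/-- Even without points to compare, a diffeomorphism of the intervals must be given; the affine one
serves. -/
theorem approx_empty {a b a' b' : ℝ} (hab : a < b) (hab' : a' < b') (f f' : Spacetime D → ℂ) :
    Approx a b f a' b' f' ∅ := by
  have h1 : (0 : ℝ) < b - a := sub_pos.2 hab
  have h2 : (0 : ℝ) < b' - a' := sub_pos.2 hab'
  have key : ∀ a b a' b' : ℝ, 0 < b - a → 0 < b' - a' →
      Set.MapsTo (fun t => a' + (t - a) / (b - a) * (b' - a')) (Set.Icc a b) (Set.Icc a' b') := by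
    intro a b a' b' h h' t ht
    have h0 : 0 ≤ (t - a) / (b - a) := div_nonneg (sub_nonneg.2 ht.1) h.le
    have h1 : (t - a) / (b - a) ≤ 1 := (div_le_one h).2 (by linarith [ht.2])
    constructor
    · nlinarith
    · nlinarith
  have inv : ∀ a b a' b' : ℝ, 0 < b - a → 0 < b' - a' → ∀ t,
      a + (a' + (t - a) / (b - a) * (b' - a') - a') / (b' - a') * (b - a) = t := by
    intro a b a' b' h h' t
    field_simp
    ring
  refine ⟨fun t => a' + (t - a) / (b - a) * (b' - a'), fun t => a + (t - a') / (b' - a') * (b - a),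
    by fun_prop, by fun_prop, key _ _ _ _ h1 h2, key _ _ _ _ h2 h1,
    ⟨fun t _ => inv _ _ _ _ h1 h2 t, fun t _ => inv _ _ _ _ h2 h1 t⟩, by simp, ?_⟩
  simp

theorem Approx.congr {a b a' b' : ℝ} {f f' g g' : Spacetime D → ℂ} {X : Set (Space D)}
    (h : Approx a b f a' b' f' X) (hfg : Set.EqOn f g (Set.Icc a b ×ˢ X))
    (hfg' : Set.EqOn f' g' (Set.Icc a' b' ×ˢ X)) : Approx a b g a' b' g' X := by
  obtain ⟨ξ, η, h1, h2, h3, h4, h5, h6, h7⟩ := h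
  refine ⟨ξ, η, h1, h2, h3, h4, h5, h6, fun t ht x hx => ?_⟩
  rw [← hfg ⟨ht, hx⟩, ← hfg' ⟨h3 ht, hx⟩]
  exact h7 t ht x hx

/-- The boundary condition on the part of a field near `X ⊆ M` and `Y ⊆ N`. -/
def BoundaryCondition (ε : ℝ) (F f g : Spacetime D → ℂ) (X Y : Set (Space D)) : Prop :=
  ∃ δ ∈ Set.Ioo 0 ε, ∃ δ' ∈ Set.Ioo 0 ε, Approx 0 δ F 0 1 f X ∧ Approx (1 - δ') 1 F 0 1 g Y

theorem boundaryCondition_empty {ε : ℝ} (hε : 0 < ε) (F f g : Spacetime D → ℂ) :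
    BoundaryCondition ε F f g ∅ ∅ :=
  ⟨ε / 2, ⟨half_pos hε, half_lt_self hε⟩, ε / 2, ⟨half_pos hε, half_lt_self hε⟩,
    approx_empty (half_pos hε) one_pos _ _,
    approx_empty (by linarith [half_pos hε]) one_pos _ _⟩

theorem BoundaryCondition.congr {ε : ℝ} {F G f f' g g' : Spacetime D → ℂ} {X Y : Set (Space D)}
    (h : BoundaryCondition ε F f g X Y) (hX : Set.EqOn F G (Set.Icc 0 ε ×ˢ X))
    (hY : Set.EqOn F G (Set.Icc (1 - ε) 1 ×ˢ Y)) (hf : Set.EqOn f f' (Set.Icc 0 1 ×ˢ X))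
    (hg : Set.EqOn g g' (Set.Icc 0 1 ×ˢ Y)) : BoundaryCondition ε G f' g' X Y := by
  obtain ⟨δ, hδ, δ', hδ', h1, h2⟩ := h
  exact ⟨δ, hδ, δ', hδ',
    h1.congr (hX.mono (Set.prod_mono_left (Set.Icc_subset_Icc_right hδ.2.le))) hf,
    h2.congr (hY.mono (Set.prod_mono_left
      (Set.Icc_subset_Icc_left (by linarith [hδ'.2])))) hg⟩

theorem sep_union_slices {M M' : Set (Space D)} (hM : ∀ x ∈ M, x.1 = 0)
    (hM' : ∀ x ∈ M', x.1 = 1) (k : ℕ) :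
    (k ≠ 0 → {y ∈ M | y.1 = k} = ∅ ∧ {y ∈ M ∪ M' | y.1 = k} = {y ∈ M' | y.1 = k}) ∧
    (k ≠ 1 → {y ∈ M' | y.1 = k} = ∅ ∧ {y ∈ M ∪ M' | y.1 = k} = {y ∈ M | y.1 = k}) := by
  have e : {y ∈ M ∪ M' | y.1 = k} = {y ∈ M | y.1 = k} ∪ {y ∈ M' | y.1 = k} := by
    ext y
    simp only [Set.mem_union, Set.mem_ofPred_eq, or_and_right]
  constructor
  · intro hk
    have : {y ∈ M | y.1 = k} = ∅ := Set.eq_empty_of_forall_notMem fun y hy =>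
      hk (by exact_mod_cast hy.2.symm.trans (hM y hy.1))
    exact ⟨this, by rw [e, this, Set.empty_union]⟩
  · intro hk
    have : {y ∈ M' | y.1 = k} = ∅ := Set.eq_empty_of_forall_notMem fun y hy =>
      hk (by exact_mod_cast hy.2.symm.trans (hM' y hy.1))
    exact ⟨this, by rw [e, this, Set.union_empty]⟩

/-- The scales `δ`, `δ'` may depend on `k`, so they need not be matched between the two pieces;
where a piece is absent the condition holds by `boundaryCondition_empty`. -/
theorem boundaryCondition_union {M N M' N' : Set (Space D)} {W W' : Set (Spacetime D)} {ε : ℝ}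
    (hε : IsCylinderScale M N W ε) (hε' : IsCylinderScale M' N' W' ε)
    (hW : ∀ x ∈ W, x.2.1 = 0) (hW' : ∀ x ∈ W', x.2.1 = 1)
    {F F₁ F₂ f f₁ f₂ g g₁ g₂ : Spacetime D → ℂ}
    (hF₁ : Set.EqOn F F₁ W) (hF₂ : Set.EqOn F F₂ W')
    (hf₁ : Set.EqOn f f₁ (Set.Icc 0 1 ×ˢ M)) (hf₂ : Set.EqOn f f₂ (Set.Icc 0 1 ×ˢ M'))
    (hg₁ : Set.EqOn g g₁ (Set.Icc 0 1 ×ˢ N)) (hg₂ : Set.EqOn g g₂ (Set.Icc 0 1 ×ˢ N')) :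
    (∀ k : ℕ, BoundaryCondition ε F f g {y ∈ M ∪ M' | y.1 = k} {y ∈ N ∪ N' | y.1 = k}) ↔
      (∀ k : ℕ, BoundaryCondition ε F₁ f₁ g₁ {y ∈ M | y.1 = k} {y ∈ N | y.1 = k}) ∧
      ∀ k : ℕ, BoundaryCondition ε F₂ f₂ g₂ {y ∈ M' | y.1 = k} {y ∈ N' | y.1 = k} := by
  rw [← forall_and]
  refine forall_congr' fun k => ?_
  have sM := sep_union_slices (hε.slice_in hW) (hε'.slice_in hW') k
  have sN := sep_union_slices (hε.slice_out hW) (hε'.slice_out hW') k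
  by_cases hk : k = 0
  · obtain ⟨a, b⟩ := sM.2 (by omega)
    obtain ⟨c, d⟩ := sN.2 (by omega)
    rw [a, b, c, d, and_iff_left (boundaryCondition_empty hε.pos _ _ _)]
    have i1 : Set.EqOn F F₁ (Set.Icc 0 ε ×ˢ {y ∈ M | y.1 = k}) :=
      fun x hx => hF₁ (hε.incoming_mem hx.1 hx.2.1)
    have i2 : Set.EqOn F F₁ (Set.Icc (1 - ε) 1 ×ˢ {y ∈ N | y.1 = k}) :=
      fun x hx => hF₁ (hε.outgoing_mem hx.1 hx.2.1)
    have i3 : Set.EqOn f f₁ (Set.Icc 0 1 ×ˢ {y ∈ M | y.1 = k}) := fun x hx => hf₁ ⟨hx.1, hx.2.1⟩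
    have i4 : Set.EqOn g g₁ (Set.Icc 0 1 ×ˢ {y ∈ N | y.1 = k}) := fun x hx => hg₁ ⟨hx.1, hx.2.1⟩
    exact ⟨fun h => h.congr i1 i2 i3 i4, fun h => h.congr i1.symm i2.symm i3.symm i4.symm⟩
  · obtain ⟨a, b⟩ := sM.1 hk
    obtain ⟨c, d⟩ := sN.1 hk
    rw [a, b, c, d, and_iff_right (boundaryCondition_empty hε.pos _ _ _)]
    have i1 : Set.EqOn F F₂ (Set.Icc 0 ε ×ˢ {y ∈ M' | y.1 = k}) :=
      fun x hx => hF₂ (hε'.incoming_mem hx.1 hx.2.1)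
    have i2 : Set.EqOn F F₂ (Set.Icc (1 - ε) 1 ×ˢ {y ∈ N' | y.1 = k}) :=
      fun x hx => hF₂ (hε'.outgoing_mem hx.1 hx.2.1)
    have i3 : Set.EqOn f f₂ (Set.Icc 0 1 ×ˢ {y ∈ M' | y.1 = k}) := fun x hx => hf₂ ⟨hx.1, hx.2.1⟩
    have i4 : Set.EqOn g g₂ (Set.Icc 0 1 ×ˢ {y ∈ N' | y.1 = k}) := fun x hx => hg₂ ⟨hx.1, hx.2.1⟩
    exact ⟨fun h => h.congr i1 i2 i3 i4, fun h => h.congr i1.symm i2.symm i3.symm i4.symm⟩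

/-- Disjoint union of fields on closed manifolds as a bijection. -/
def ClosedField.unionEquiv {M M' : Set (Space D)} (hM : ∀ x ∈ M, x.1 = 0)
    (hM' : ∀ x ∈ M', x.1 = 1) :
    ClosedField n M × ClosedField n M' ≃ ClosedField n (M ∪ M') :=
  (Equiv.subtypeProdEquivProd (p := fun f : FoldField n (Set.Icc (0 : ℝ) 1 ×ˢ M) =>
      (action f).IsIdentity) (q := fun f : FoldField n (Set.Icc (0 : ℝ) 1 ×ˢ M') =>
      (action f).IsIdentity)).symm.trans <|
    Equiv.subtypeEquiv
      (FoldField.unionEquiv (fun x hx => hM x.2 hx.2) (fun x hx => hM' x.2 hx.2) Set.prod_union)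
      -- One direction shows that a union of fields on closed manifolds is again such a field, the
      -- other that its restrictions are.
      fun p => by rw [action_unionEquiv, BrauerMor.isIdentity_tensor]

theorem ClosedField.isDisjointUnionMap_unionEquiv {M M' : Set (Space D)}
    (hM : ∀ x ∈ M, x.1 = 0) (hM' : ∀ x ∈ M', x.1 = 1) :
    IsDisjointUnionMap (n := n) (ClosedField.unionEquiv hM hM') :=
  fun f f' => FoldField.unionEquiv_eqOn _ _ _ (f.1, f'.1)

/-! ### Fields with boundary conditions and the state sum. -/

section

variable {M N M' N' : Set (Space D)} {W W' : Set (Spacetime D)} {ε : ℝ}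
  {fM : ClosedField n M} {fN : ClosedField n N} {fM' : ClosedField n M'} {fN' : ClosedField n N'}
  {f : ClosedField n (M ∪ M')} {g : ClosedField n (N ∪ N')}

/-- Membership in `FieldsWithBoundary` unfolds to `BoundaryCondition` in every slice. -/
theorem unionEquiv_mem_fieldsWithBoundary
    (hε : IsCylinderScale M N W ε) (hε' : IsCylinderScale M' N' W' ε)
    (hW : ∀ x ∈ W, x.2.1 = 0) (hW' : ∀ x ∈ W', x.2.1 = 1)
    (hf : Set.EqOn f.fn fM.fn (Set.Icc 0 1 ×ˢ M)) (hf' : Set.EqOn f.fn fM'.fn (Set.Icc 0 1 ×ˢ M'))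
    (hg : Set.EqOn g.fn fN.fn (Set.Icc 0 1 ×ˢ N)) (hg' : Set.EqOn g.fn fN'.fn (Set.Icc 0 1 ×ˢ N'))
    (p : FoldField n W × FoldField n W') :
    (p.1 ∈ FieldsWithBoundary n W ε fM fN ∧ p.2 ∈ FieldsWithBoundary n W' ε fM' fN') ↔
      FoldField.unionEquiv hW hW' rfl p ∈ FieldsWithBoundary n (W ∪ W') ε f g :=
  have e := FoldField.unionEquiv_eqOn hW hW' rfl p
  (boundaryCondition_union hε hε' hW hW' e.1 e.2 hf hf' hg hg').symm

/-- Disjoint union of fields with prescribed boundary conditions as a bijection. -/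
def FieldsWithBoundary.unionEquiv
    (hε : IsCylinderScale M N W ε) (hε' : IsCylinderScale M' N' W' ε)
    (hW : ∀ x ∈ W, x.2.1 = 0) (hW' : ∀ x ∈ W', x.2.1 = 1)
    (hf : Set.EqOn f.fn fM.fn (Set.Icc 0 1 ×ˢ M)) (hf' : Set.EqOn f.fn fM'.fn (Set.Icc 0 1 ×ˢ M'))
    (hg : Set.EqOn g.fn fN.fn (Set.Icc 0 1 ×ˢ N))
    (hg' : Set.EqOn g.fn fN'.fn (Set.Icc 0 1 ×ˢ N')) :
    FieldsWithBoundary n W ε fM fN × FieldsWithBoundary n W' ε fM' fN' ≃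
      FieldsWithBoundary n (W ∪ W') ε f g :=
  (Equiv.subtypeProdEquivProd (p := fun F => F ∈ FieldsWithBoundary n W ε fM fN)
      (q := fun F => F ∈ FieldsWithBoundary n W' ε fM' fN')).symm.trans <|
    Equiv.subtypeEquiv (FoldField.unionEquiv hW hW' rfl)
      (unionEquiv_mem_fieldsWithBoundary hε hε' hW hW' hf hf' hg hg')

/-- The state sum of a disjoint union is the product of the state sums. -/
theorem stateSum_union {V : Type*} [AddCommGroup V] [Module ℝ V] [Module.Finite ℝ V]
    {𝒟 : DualityStructure V} (hY : 𝒟.LoopFaithful)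
    (hε : IsCylinderScale M N W ε) (hε' : IsCylinderScale M' N' W' ε)
    (hW : ∀ x ∈ W, x.2.1 = 0) (hW' : ∀ x ∈ W', x.2.1 = 1)
    (hf : Set.EqOn f.fn fM.fn (Set.Icc 0 1 ×ˢ M)) (hf' : Set.EqOn f.fn fM'.fn (Set.Icc 0 1 ×ˢ M'))
    (hg : Set.EqOn g.fn fN.fn (Set.Icc 0 1 ×ˢ N))
    (hg' : Set.EqOn g.fn fN'.fn (Set.Icc 0 1 ×ˢ N')) :
    stateSum 𝒟 n (M ∪ M') (N ∪ N') (W ∪ W') ε (f, g) =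
      DualityStructure.Q.times 𝒟 (stateSum 𝒟 n M N W ε (fM, fN))
        (stateSum 𝒟 n M' N' W' ε (fM', fN')) := by
  unfold stateSum
  exact hY.isum_tensor _ _ _ (FieldsWithBoundary.unionEquiv hε hε' hW hW' hf hf' hg hg')
    fun F F' => action_unionEquiv hW hW' rfl (F.1, F'.1)

end

end FoldTFT

end

/-! ### The theorem. -/

theorem mainTheorem6
    {V : Type*} [AddCommGroup V] [Module ℝ V] [Module.Finite ℝ V]
    (hV : 2 ≤ Module.finrank ℝ V)
    (𝒟 : FoldTFT.DualityStructure V) (hY : 𝒟.LoopFaithful)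
    (n D : ℕ) (hn : 2 ≤ n) (hD : 2 * n + 1 ≤ D)
    (M N M' N' : Set (FoldTFT.Space D)) (W W' : Set (FoldTFT.Spacetime D))
    (hW : FoldTFT.IsCobordism n M N W) (hW' : FoldTFT.IsCobordism n M' N' W')
    (hslice : ∀ x ∈ W, x.2.1 = 0) (hslice' : ∀ x ∈ W', x.2.1 = 1)
    (ε : ℝ) (hε : FoldTFT.IsCylinderScale M N W ε) (hε' : FoldTFT.IsCylinderScale M' N' W' ε) :
    FoldTFT.IsCobordism n (M ∪ M') (N ∪ N') (W ∪ W') ∧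
    FoldTFT.IsCylinderScale (M ∪ M') (N ∪ N') (W ∪ W') ε ∧
    ∃ (jM : FoldTFT.ClosedField n M × FoldTFT.ClosedField n M' ≃ FoldTFT.ClosedField n (M ∪ M'))
      (jN : FoldTFT.ClosedField n N × FoldTFT.ClosedField n N' ≃ FoldTFT.ClosedField n (N ∪ N')),
      FoldTFT.IsDisjointUnionMap jM ∧ FoldTFT.IsDisjointUnionMap jN ∧
      FoldTFT.rho 𝒟 jM jN (FoldTFT.stateSum 𝒟 n (M ∪ M') (N ∪ N') (W ∪ W') ε) =
        FoldTFT.monoidalTensor 𝒟 (FoldTFT.stateSum 𝒟 n M N W ε)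
          (FoldTFT.stateSum 𝒟 n M' N' W' ε) := by
  have hM := hε.slice_in hslice
  have hM' := hε'.slice_in hslice'
  have hN := hε.slice_out hslice
  have hN' := hε'.slice_out hslice'
  have dM := FoldTFT.ClosedField.isDisjointUnionMap_unionEquiv (n := n) hM hM'
  have dN := FoldTFT.ClosedField.isDisjointUnionMap_unionEquiv (n := n) hN hN'
  refine ⟨hW.union hW' hslice hslice' hε hε', hε.union hε',
    FoldTFT.ClosedField.unionEquiv hM hM', FoldTFT.ClosedField.unionEquiv hN hN', dM, dN, ?_⟩
  -- `ρ` evaluates at the disjoint unions of fields, so the identity is checked one quadruple at a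
  -- time.
  funext ⟨fM, fM', fN, fN'⟩
  exact FoldTFT.stateSum_union hY hε hε' hslice hslice' (dM fM fM').1 (dM fM fM').2
    (dN fN fN').1 (dN fN fN').2
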